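/- Let $\mathbb S^2\subset\mathbb R^3$ be the unit sphere with surface measure $dA$ and Poisson bracket $\{f,g\}(x)=x\cdot(\nabla f(x)\times\nabla g(x))$, where $\nabla$ is the surface gradient. Let $\psi\in C^1(\mathbb S^2)$ be generic, i.e. its set of critical points $\{x:\nabla\psi(x)=0\}$ has zero surface measure and is nowhere dense. Let $$\mathrm{stab}_\psi=\Big\{f\in L^2(\mathbb S^2)\;:\;\int_{\mathbb S^2} f\,\{\psi,\phi\}\,dA=0\ \text{ for all }\phi\in C^\infty(\mathbb S^2)\Big\},$$ that is, the set of $f\in L^2(\mathbb S^2)$ with $\{f,\psi\}=0$ weakly. For $x\in\mathbb S^2$ let $\gamma_x$ be the connected component containing $x$ of the streamline $\{y:\psi(y)=\psi(x)\}$, and define the averaging projector by $$(\Pi_\psi f)(x)=\frac1{\operatorname{length}(\gamma_x)}\int_{\gamma_x} f\,ds,$$ where $ds$ and length refer to one-dimensional Hausdorff measure, and $(\Pi_\psi f)(x)=f(x)$ if $\gamma_x=\{x\}$. (Exceptional points where this is not meaningful, e.g. where the length is infinite, are given the value $0$.) Then for every $\omega\in L^\infty(\mathbb S^2)$ (and every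 choice of representative of $\omega$): 1. $\omega\in\mathrm{stab}_\psi$ if and only if $\Pi_\psi\omega=\omega$ almost everywhere; 2. $\omega\in\mathrm{stab}_\psi$ if and only if $\omega$ is constant on the connected components of the streamlines of $\psi$, in the sense that $\omega$ agrees almost everywhere with a function that is constant on every connected component of every level set of $\psi$. -/

import Mathlib

open MeasureTheory Metric
open scoped Manifold ContDiff Matrix

noncomputable section

namespace StreamlineAveraging

/-- Euclidean three-space. -/
abbrev E3 : Type := EuclideanSpace ℝ (Fin 3)

/-- The unit sphere in Euclidean three-space. -/
abbrev S2 : Type := sphere (0 : E3) 1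

/-- The standard surface (area) measure on the unit sphere. -/
def area : Measure S2 := (volume : Measure E3).toSphere

theorem normalize_mem_sphere {y : E3} (hy : y ≠ 0) : ‖y‖⁻¹ • y ∈ sphere (0 : E3) 1 := by
  rw [mem_sphere_zero_iff_norm, norm_smul, norm_inv, norm_norm]
  exact inv_mul_cancel₀ (norm_ne_zero_iff.mpr hy)

open Classical in
/-- The extension of `f` to three-space that is constant along open rays from the origin
(its value at the origin is irrelevant). -/
def radialExtension (f : S2 → ℝ) (y : E3) : ℝ :=
  if hy : y = 0 then 0 else f ⟨‖y‖⁻¹ • y, normalize_mem_sphere hy⟩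

/-- The surface gradient of `f` at `x`, as a vector of the ambient space. It is the Euclidean
gradient at `x` of the radially constant extension, so it is tangent to the sphere. -/
def surfaceGradient (f : S2 → ℝ) (x : S2) : E3 :=
  gradient (radialExtension f) (x : E3)

/-- The Poisson bracket `{f, g}(x) = x · (∇f × ∇g)` of differentiable functions on the sphere. -/
def poissonBracket (f g : S2 → ℝ) (x : S2) : ℝ :=
  (x : E3).ofLp ⬝ᵥ ((surfaceGradient f x).ofLp ⨯₃ (surfaceGradient g x).ofLp)

/-- The weak Poisson bracket `{ψ, w}`, as a functional of the test function `φ`: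
`∫ {ψ, w} φ = - ∫ w {ψ, φ}`. -/
def weakPoissonBracket (ψ w φ : S2 → ℝ) : ℝ :=
  - ∫ x, w x * poissonBracket ψ φ x ∂area

/-- The stabilizer of `ψ`: the square-integrable functions whose weak Poisson bracket with `ψ`
vanishes against every smooth test function. -/
def stab (ψ : S2 → ℝ) : Set (S2 → ℝ) :=
  {f | MemLp f 2 area ∧
    ∀ φ : S2 → ℝ, ContMDiff (𝓡 2) 𝓘(ℝ, ℝ) ∞ φ → weakPoissonBracket ψ f φ = 0}

/-- The set of critical points of `ψ`. -/
def criticalSet (ψ : S2 → ℝ) : Set S2 := {x | surfaceGradient ψ x = 0}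

/-- A `C¹` stream function whose critical points form a null and nowhere dense set. -/
structure IsGeneric (ψ : S2 → ℝ) : Prop where
  contMDiff : ContMDiff (𝓡 2) 𝓘(ℝ, ℝ) 1 ψ
  area_criticalSet : area (criticalSet ψ) = 0
  isNowhereDense_criticalSet : IsNowhereDense (criticalSet ψ)

/-- The connected component through `x` of the streamline (level set of `ψ`) through `x`. -/
def streamlineComponent (ψ : S2 → ℝ) (x : S2) : Set S2 :=
  connectedComponentIn (ψ ⁻¹' {ψ x}) x

open Classical in
/-- The streamline averaging projector `Π_ψ`: on each connected component `γ` of a streamline,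
`Π_ψ f` is `(1 / length γ) ∫_γ f ds`, where length is the one-dimensional Hausdorff measure;
on a component reduced to a single point it is the value of `f` there. -/
def streamlineAverage (ψ f : S2 → ℝ) (x : S2) : ℝ :=
  if (streamlineComponent ψ x).Subsingleton then f x
  else ⨍ y in streamlineComponent ψ x, f y ∂(μH[1] : Measure S2)

/-- `g` is constant on every connected component of every streamline of `ψ`. -/
def IsConstantOnStreamlineComponents (ψ g : S2 → ℝ) : Prop :=
  ∀ x, ∀ y ∈ streamlineComponent ψ x, g y = g x

end StreamlineAveraging

end

noncomputable section

namespace StreamlineAveraging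

open Filter Topology Set
open scoped Convolution

/-! ### Calculus of the planar Jacobian bracket -/

/-! In the stereographic chart from the south pole the density of `area` cancels the conformal
factor of the bracket, so testing against functions supported in the chart says that the planar
field `w ∇ψ` has zero distributional curl.

From stabiliser to constancy: mollifications of `w ∇ψ` are curl free, hence gradients, and a
compactness argument produces a locally Lipschitz potential `H` (`exists_isPotential`). Near a
regular point, coordinates containing `ψ` give `H = G ∘ ψ`, with `w = G' ∘ ψ` almost everywhere
(`IsPotential.exists_local_factor`). The difficulty is to compare different `G` along one component,
which may run through critical points. The map `(ψ, H)` is locally Lipschitz, so it sends the null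
critical set to a null set; by Fubini, `H` maps the critical points of almost every level to a null
set of reals, while the regular points of a level contribute only countably many values. The image
of a component is then connected and null, hence a point. So two factors `G` met by one component
agree at its level `c`, and, apart from countably many `c`, so do their derivatives: `w` has one
value per component (`exists_isConstantOn_of_stab`).

From constancy to stabiliser: a layer-cake formula reduces `w` to indicators of saturated sets, and
inner regularity reduces those to unions of the components meeting a compact set. Components of a
compact level set are intersections of clopen sets, so such a union is a limit of `C¹` cutoffs `F`
with gradient parallel to that of `ψ`. For these, `F {ψ, φ} = {ψ, F φ}` has zero integral
(`setIntegral_streamHull`, `setIntegral_saturated`).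

Averaging: `streamlineAverage ψ w` is always constant on components. Conversely, Eilenberg's
inequality shows that almost every level has locally finite length in the chart and meets the null
set where `w` differs from a streamline-constant `g` in zero length, so averaging recovers `w`
(`streamlineAverage_ae_eq`). -/

/-- The Jacobian determinant of the pair `(f, g)` of functions on the plane. -/
def planarBracket (f g : ℝ × ℝ → ℝ) (p : ℝ × ℝ) : ℝ :=
  fderiv ℝ f p (1, 0) * fderiv ℝ g p (0, 1) - fderiv ℝ f p (0, 1) * fderiv ℝ g p (1, 0)

theorem continuous_fderiv_apply_const {f : ℝ × ℝ → ℝ} (hf : ContDiff ℝ 1 f) (v : ℝ × ℝ) :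
    Continuous fun p => fderiv ℝ f p v :=
  (hf.continuous_fderiv one_ne_zero).clm_apply continuous_const

theorem continuous_planarBracket {f g : ℝ × ℝ → ℝ} (hf : ContDiff ℝ 1 f) (hg : ContDiff ℝ 1 g) :
    Continuous (planarBracket f g) :=
  ((continuous_fderiv_apply_const hf _).mul (continuous_fderiv_apply_const hg _)).sub
    ((continuous_fderiv_apply_const hf _).mul (continuous_fderiv_apply_const hg _))

theorem planarBracket_swap (f g : ℝ × ℝ → ℝ) (p : ℝ × ℝ) :
    planarBracket f g p = -planarBracket g f p := by
  unfold planarBracket; ring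

theorem planarBracket_eq_zero_of_notMem_tsupport {f g : ℝ × ℝ → ℝ} {p : ℝ × ℝ}
    (hp : p ∉ tsupport g) : planarBracket f g p = 0 := by
  have : fderiv ℝ g p = 0 := by
    by_contra h
    exact hp (support_fderiv_subset ℝ h)
  simp [planarBracket, this]

/-- Integration by parts arranged so that both derivatives land on `φ`; `f` is only once
differentiable. -/
theorem integral_fderiv_mul_fderiv {f φ : ℝ × ℝ → ℝ} (hf : ContDiff ℝ 1 f) (hφ : ContDiff ℝ 2 φ)
    (hc : HasCompactSupport f ∨ HasCompactSupport φ) (v v' : ℝ × ℝ) :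
    ∫ p, fderiv ℝ φ p v' * fderiv ℝ f p v = - ∫ p, fderiv ℝ (fderiv ℝ φ) p v v' * f p := by
  have hφ' : ContDiff ℝ 1 (fun p => fderiv ℝ φ p v') :=
    (hφ.fderiv_right (m := 1) (by norm_num)).clm_apply contDiff_const
  have hd : ∀ p, fderiv ℝ (fun q => fderiv ℝ φ q v') p v = fderiv ℝ (fderiv ℝ φ) p v v' := by
    intro p
    have h1 : DifferentiableAt ℝ (fderiv ℝ φ) p :=
      ((hφ.fderiv_right (m := 1) (by norm_num)).differentiable one_ne_zero) p
    rw [(h1.hasFDerivAt.clm_apply (hasFDerivAt_const v' p)).fderiv]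
    simp
  have cf := hf.continuous
  have cφ := hφ'.continuous
  have cdf := continuous_fderiv_apply_const hf v
  have cdφ := continuous_fderiv_apply_const hφ' v
  have supp : ∀ {g : ℝ × ℝ → ℝ}, HasCompactSupport g → ∀ u : ℝ × ℝ,
      HasCompactSupport fun p => fderiv ℝ g p u := fun hg u => hg.fderiv_apply ℝ u
  rw [integral_mul_fderiv_eq_neg_fderiv_mul_of_integrable (f := fun p => fderiv ℝ φ p v') (g := f)
    (v := v)]
  · simp_rw [hd]
  · refine (cdφ.mul cf).integrable_of_hasCompactSupport ?_
    rcases hc with hc | hc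
    · exact hc.mul_left
    · exact (supp (supp hc v') v).mul_right
  · refine (cφ.mul cdf).integrable_of_hasCompactSupport ?_
    rcases hc with hc | hc
    · exact (supp hc v).mul_left
    · exact (supp hc v').mul_right
  · refine (cφ.mul cf).integrable_of_hasCompactSupport ?_
    rcases hc with hc | hc
    · exact hc.mul_left
    · exact (supp hc v').mul_right
  · exact fun p _ => hφ'.differentiable one_ne_zero p
  · exact fun p _ => hf.differentiable one_ne_zero p

theorem integral_planarBracket_eq_zero {f φ : ℝ × ℝ → ℝ} (hf : ContDiff ℝ 1 f)
    (hφ : ContDiff ℝ 2 φ) (hc : HasCompactSupport f ∨ HasCompactSupport φ) :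
    ∫ p, planarBracket f φ p = 0 := by
  have hφ1 : ContDiff ℝ 1 φ := hφ.of_le (by norm_num)
  have hint : ∀ v v' : ℝ × ℝ, Integrable fun p => fderiv ℝ φ p v' * fderiv ℝ f p v := by
    intro v v'
    refine ((continuous_fderiv_apply_const hφ1 v').mul
      (continuous_fderiv_apply_const hf v)).integrable_of_hasCompactSupport ?_
    rcases hc with hc | hc
    · exact (hc.fderiv_apply ℝ v).mul_left
    · exact (hc.fderiv_apply ℝ v').mul_right
  have hsymm : ∀ p (v v' : ℝ × ℝ),
      fderiv ℝ (fderiv ℝ φ) p v v' = fderiv ℝ (fderiv ℝ φ) p v' v := fun p v v' =>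
    (hφ.contDiffAt.isSymmSndFDerivAt (by simp)) v v'
  calc ∫ p, planarBracket f φ p
      = ∫ p, (fderiv ℝ φ p (0, 1) * fderiv ℝ f p (1, 0)
          - fderiv ℝ φ p (1, 0) * fderiv ℝ f p (0, 1)) := by
        congr 1; ext p; unfold planarBracket; ring
    _ = 0 := by
        rw [integral_sub (hint _ _) (hint _ _), integral_fderiv_mul_fderiv hf hφ hc,
          integral_fderiv_mul_fderiv hf hφ hc]
        simp_rw [hsymm _ (1, 0) (0, 1)]
        simp

theorem bilin_symm_of_basis {B : ℝ × ℝ →L[ℝ] ℝ × ℝ →L[ℝ] ℝ}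
    (h : B (1, 0) (0, 1) = B (0, 1) (1, 0)) (x y : ℝ × ℝ) : B x y = B y x := by
  have hx : ∀ x : ℝ × ℝ, x = x.1 • ((1, 0) : ℝ × ℝ) + x.2 • ((0, 1) : ℝ × ℝ) := fun x => by
    ext <;> simp
  rw [hx x, hx y]
  simp only [map_add, map_smul, add_apply, smul_apply,
    smul_eq_mul, h]
  ring

/-! ### Potentials of weakly closed fields -/

/-- A sequence of bump functions shrinking to the origin of the plane. -/
def bump (n : ℕ) : ContDiffBump (0 : ℝ × ℝ) where
  rIn := 1 / (2 * ((n : ℝ) + 1))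
  rOut := 1 / ((n : ℝ) + 1)
  rIn_pos := by positivity
  rIn_lt_rOut := by
    apply one_div_lt_one_div_of_lt (by positivity)
    have : (0 : ℝ) < n + 1 := by positivity
    linarith

theorem locallyIntegrable_smul_fderiv {ψ w : ℝ × ℝ → ℝ} (hψ : ContDiff ℝ 1 ψ) (hw : Measurable w)
    {M : ℝ} (hM : ∀ p, |w p| ≤ M) : LocallyIntegrable fun p => w p • fderiv ℝ ψ p := by
  have hc := hψ.continuous_fderiv one_ne_zero
  refine LocallyIntegrable.mono (f := fun p => M • fderiv ℝ ψ p) (hc.const_smul M).locallyIntegrable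
    (hw.aestronglyMeasurable.smul hc.aestronglyMeasurable) (Eventually.of_forall fun p => ?_)
  rw [norm_smul, norm_smul]
  gcongr
  exact (hM p).trans (le_abs_self M)

/-- Mollification averages `W` over points at distance at most one, which makes the bound uniform in
`n`. -/
theorem norm_mollify_le {W : ℝ × ℝ → (ℝ × ℝ →L[ℝ] ℝ)} {C : ℝ} {p : ℝ × ℝ}
    (hC : ∀ q ∈ closedBall p 1, ‖W q‖ ≤ C) (n : ℕ) :
    ‖(((bump n).normed volume) ⋆[ContinuousLinearMap.lsmul ℝ ℝ, volume] W) p‖ ≤ C := by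
  have h0 : ∀ t, 0 ≤ (bump n).normed volume t := (bump n).nonneg_normed
  calc ‖(((bump n).normed volume) ⋆[ContinuousLinearMap.lsmul ℝ ℝ, volume] W) p‖
      ≤ ∫ t, (bump n).normed volume t * C := by
        refine norm_integral_le_of_norm_le ((bump n).integrable_normed.mul_const C)
          (Eventually.of_forall fun t => ?_)
        simp only [ContinuousLinearMap.lsmul_apply, norm_smul, Real.norm_eq_abs, abs_of_nonneg (h0 t)]
        by_cases ht : t ∈ Function.support ((bump n).normed volume)
        · rw [(bump n).support_normed_eq] at ht
          gcongr
          · exact h0 t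
          apply hC
          rw [mem_closedBall, dist_eq_norm]
          simp only [mem_ball, dist_zero_right] at ht
          have : (bump n).rOut ≤ 1 := by
            show 1 / ((n : ℝ) + 1) ≤ 1
            rw [div_le_one (by positivity)]
            linarith [n.cast_nonneg (α := ℝ)]
          calc ‖p - t - p‖ = ‖t‖ := by rw [show p - t - p = -t by abel, norm_neg]
            _ ≤ 1 := ht.le.trans this
        · rw [Function.notMem_support] at ht
          simp [ht]
    _ = C := by rw [integral_mul_const, (bump n).integral_normed, one_mul]

/-- The antisymmetric part of the derivative at `p` is the integral of `w` against the bracket of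
`ψ` with the reflected mollifier centred at `p`, which is an admissible test function. -/
theorem mollify_symm {ψ w : ℝ × ℝ → ℝ} (hψ : ContDiff ℝ 1 ψ) (hw : Measurable w) {M : ℝ}
    (hM : ∀ p, |w p| ≤ M)
    (h : ∀ φ : ℝ × ℝ → ℝ, ContDiff ℝ ∞ φ → HasCompactSupport φ → ∫ p, w p * planarBracket ψ φ p = 0)
    (n : ℕ) (p x y : ℝ × ℝ) :
    fderiv ℝ (((bump n).normed volume) ⋆[ContinuousLinearMap.lsmul ℝ ℝ, volume]
        fun p => w p • fderiv ℝ ψ p) p x y =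
      fderiv ℝ (((bump n).normed volume) ⋆[ContinuousLinearMap.lsmul ℝ ℝ, volume]
        fun p => w p • fderiv ℝ ψ p) p y x := by
  set ρ := (bump n).normed (volume : Measure (ℝ × ℝ)) with hρ
  set W : ℝ × ℝ → (ℝ × ℝ →L[ℝ] ℝ) := fun p => w p • fderiv ℝ ψ p with hW
  have hWl : LocallyIntegrable W := locallyIntegrable_smul_fderiv hψ hw hM
  have hρc : HasCompactSupport ρ := (bump n).hasCompactSupport_normed
  have hρs : ContDiff ℝ ∞ ρ := (bump n).contDiff_normed
  have hρ1 : ContDiff ℝ 1 ρ := (bump n).contDiff_normed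
  rw [(hρc.hasFDerivAt_convolution_left (ContinuousLinearMap.lsmul ℝ ℝ) hρ1 hWl p).fderiv]
  apply bilin_symm_of_basis
  have hI : Integrable fun t => ((ContinuousLinearMap.lsmul ℝ ℝ :
      ℝ →L[ℝ] (ℝ × ℝ →L[ℝ] ℝ) →L[ℝ] (ℝ × ℝ →L[ℝ] ℝ)).precompL (ℝ × ℝ)) (fderiv ℝ ρ t) (W (p - t)) :=
    HasCompactSupport.convolutionExists_left (𝕜 := ℝ) (F := ℝ × ℝ →L[ℝ] ℝ × ℝ →L[ℝ] ℝ) _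
      (hρc.fderiv (𝕜 := ℝ)) (hρ1.continuous_fderiv one_ne_zero) hWl p
  have happ : ∀ v v' : ℝ × ℝ, (∫ t, ((ContinuousLinearMap.lsmul ℝ ℝ :
      ℝ →L[ℝ] (ℝ × ℝ →L[ℝ] ℝ) →L[ℝ] (ℝ × ℝ →L[ℝ] ℝ)).precompL (ℝ × ℝ)) (fderiv ℝ ρ t)
        (W (p - t))) v v' = ∫ t, fderiv ℝ ρ t v * W (p - t) v' := by
    intro v v'
    rw [ContinuousLinearMap.integral_apply hI, ContinuousLinearMap.integral_apply]
    · rfl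
    · exact hI.apply_continuousLinearMap v
  have hint : ∀ v v' : ℝ × ℝ, Integrable fun t => fderiv ℝ ρ t v * W (p - t) v' := by
    intro v v'
    exact (hI.apply_continuousLinearMap v).apply_continuousLinearMap v'
  simp only [convolution]
  rw [happ, happ, ← sub_eq_zero, ← integral_sub (hint _ _) (hint _ _)]
  have hη : ∀ t v, fderiv ℝ (fun t => ρ (p - t)) t v = - fderiv ℝ ρ (p - t) v := by
    intro t v
    have h1 : HasFDerivAt (fun t : ℝ × ℝ => p - t) (-(ContinuousLinearMap.id ℝ (ℝ × ℝ))) t :=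
      (hasFDerivAt_id t).const_sub p
    have h2 := ((hρ1.differentiable one_ne_zero (p - t)).hasFDerivAt.comp t h1).fderiv
    rw [show (fun t => ρ (p - t)) = ρ ∘ fun t => p - t from rfl, h2]
    simp
  have key := h (fun t => ρ (p - t)) (hρs.comp (contDiff_const.sub contDiff_id))
    (hρc.comp_homeomorph (Homeomorph.subLeft p))
  rw [← integral_sub_left_eq_self _ _ p] at key
  refine (integral_congr_ae (Eventually.of_forall fun t => ?_)).trans key
  simp only [planarBracket, hη, hW, sub_sub_cancel, smul_apply, smul_eq_mul]
  ring

end StreamlineAveraging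

end

noncomputable section

namespace StreamlineAveraging

open Filter Topology Set
open scoped Convolution

/-! ### Compactness and existence of potentials. -/

/-- A locally equi-Lipschitz sequence of functions vanishing at the origin has a pointwise
convergent subsequence. -/
theorem exists_subseq_tendsto {F : ℕ → ℝ × ℝ → ℝ} (h0 : ∀ n, F n 0 = 0)
    (hF : ∀ R : ℝ, ∃ C : ℝ, ∀ n, ∀ p ∈ closedBall (0 : ℝ × ℝ) R, ∀ q ∈ closedBall (0 : ℝ × ℝ) R,
      |F n p - F n q| ≤ C * dist p q) :
    ∃ κ : ℕ → ℕ, StrictMono κ ∧ ∃ H : ℝ × ℝ → ℝ, ∀ p, Tendsto (fun n => F (κ n) p) atTop (𝓝 (H p)) := by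
  set D := TopologicalSpace.denseSeq (ℝ × ℝ)
  have hb : ∀ k, ∃ b : ℝ, ∀ n, F n (D k) ∈ Icc (-b) b := by
    intro k
    obtain ⟨C, hC⟩ := hF ‖D k‖
    refine ⟨C * dist (D k) 0, fun n => ?_⟩
    have := hC n (D k) (by simp) 0 (by simp)
    rw [h0, sub_zero] at this
    exact abs_le.1 this
  choose b hb using hb
  -- Sequential compactness of a countable product of intervals replaces the diagonal extraction
  -- over a dense sequence.
  obtain ⟨a, -, κ, hκ, hlim⟩ := (isCompact_univ_pi fun k => isCompact_Icc (a := -b k)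
    (b := b k)).tendsto_subseq (x := fun n k => F n (D k)) fun n k _ => hb k n
  rw [tendsto_pi_nhds] at hlim
  refine ⟨κ, hκ, ?_⟩
  suffices h : ∀ p, ∃ l, Tendsto (fun n => F (κ n) p) atTop (𝓝 l) from ⟨_, fun p => (h p).choose_spec⟩
  intro p
  apply cauchySeq_tendsto_of_complete
  rw [Metric.cauchySeq_iff']
  intro ε hε
  obtain ⟨C, hC⟩ := hF (‖p‖ + 1)
  set δ := min 1 (ε / (4 * (|C| + 1))) with hδ
  have hδ0 : 0 < δ := lt_min one_pos (by positivity)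
  obtain ⟨k, hk⟩ := (TopologicalSpace.denseRange_denseSeq (ℝ × ℝ)).exists_dist_lt p hδ0
  change dist p (D k) < δ at hk
  have hpk : ∀ n, |F n p - F n (D k)| ≤ ε / 4 := by
    intro n
    have h1 : D k ∈ closedBall (0 : ℝ × ℝ) (‖p‖ + 1) := by
      rw [mem_closedBall, dist_comm]
      calc dist 0 (D k) ≤ dist 0 p + dist p (D k) := dist_triangle _ _ _
        _ ≤ ‖p‖ + 1 := by
          rw [dist_zero_left]
          linarith [min_le_left 1 (ε / (4 * (|C| + 1)))]
    calc |F n p - F n (D k)| ≤ C * dist p (D k) := hC n p (by simp) _ h1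
      _ ≤ (|C| + 1) * (ε / (4 * (|C| + 1))) := by
        gcongr
        · linarith [le_abs_self C]
        · exact hk.le.trans (min_le_right _ _)
      _ = ε / 4 := by field_simp
  obtain ⟨N, hN⟩ := Metric.cauchySeq_iff'.1 (hlim k).cauchySeq (ε / 4) (by positivity)
  refine ⟨N, fun n hn => ?_⟩
  have h1 := hpk (κ n)
  have h2 := hpk (κ N)
  have h3 := hN n hn
  simp only [Function.comp, Real.dist_eq] at h3 ⊢
  rw [abs_le] at h1 h2
  rw [abs_lt] at h3 ⊢
  constructor <;> linarith [h1.1, h1.2, h2.1, h2.2, h3.1, h3.2]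

/-- `H` is a potential of the field `w ∇ψ`, in the sense that it is the limit of smooth functions
whose gradients are locally bounded and converge to `w ∇ψ` almost everywhere. -/
structure IsPotential (ψ w H : ℝ × ℝ → ℝ) (Hn : ℕ → ℝ × ℝ → ℝ) : Prop where
  contDiff : ∀ n, ContDiff ℝ 2 (Hn n)
  tendsto : ∀ p, Tendsto (fun n => Hn n p) atTop (𝓝 (H p))
  bound : ∀ R : ℝ, ∃ C : ℝ, ∀ n, ∀ p ∈ closedBall (0 : ℝ × ℝ) R, ‖fderiv ℝ (Hn n) p‖ ≤ C
  tendsto_fderiv : ∀ᵐ p, Tendsto (fun n => fderiv ℝ (Hn n) p) atTop (𝓝 (w p • fderiv ℝ ψ p))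

theorem abs_sub_le_of_fderiv_bound {f : ℝ × ℝ → ℝ} (hf : Differentiable ℝ f) {R C : ℝ}
    (hC : ∀ p ∈ closedBall (0 : ℝ × ℝ) R, ‖fderiv ℝ f p‖ ≤ C) {p q : ℝ × ℝ}
    (hp : p ∈ closedBall (0 : ℝ × ℝ) R) (hq : q ∈ closedBall (0 : ℝ × ℝ) R) :
    |f p - f q| ≤ C * dist p q := by
  rw [dist_eq_norm]
  exact (convex_closedBall (0 : ℝ × ℝ) R).norm_image_sub_le_of_norm_fderiv_le
    (fun x _ => hf x) hC hq hp

/-- A bounded function whose weak bracket with `ψ` vanishes gives a field `w ∇ψ` with a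
potential. -/
theorem exists_isPotential {ψ w : ℝ × ℝ → ℝ} (hψ : ContDiff ℝ 1 ψ) (hw : Measurable w) {M : ℝ}
    (hM : ∀ p, |w p| ≤ M)
    (h : ∀ φ : ℝ × ℝ → ℝ, ContDiff ℝ ∞ φ → HasCompactSupport φ →
      ∫ p, w p * planarBracket ψ φ p = 0) :
    ∃ H Hn, IsPotential ψ w H Hn := by
  set W : ℝ × ℝ → (ℝ × ℝ →L[ℝ] ℝ) := fun p => w p • fderiv ℝ ψ p with hW
  set V : ℕ → ℝ × ℝ → (ℝ × ℝ →L[ℝ] ℝ) := fun n =>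
    ((bump n).normed volume) ⋆[ContinuousLinearMap.lsmul ℝ ℝ, volume] W with hV
  have hWl : LocallyIntegrable W := locallyIntegrable_smul_fderiv hψ hw hM
  have hVs : ∀ n, ContDiff ℝ 1 (V n) := fun n =>
    (bump n).hasCompactSupport_normed.contDiff_convolution_left (n := 1) _
      (bump n).contDiff_normed hWl
  have hVb : ∀ R : ℝ, ∃ C : ℝ, ∀ n, ∀ p ∈ closedBall (0 : ℝ × ℝ) R, ‖V n p‖ ≤ C := by
    intro R
    obtain ⟨C, hC⟩ := (isCompact_closedBall (0 : ℝ × ℝ) (R + 1)).exists_bound_of_continuousOn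
      (hψ.continuous_fderiv one_ne_zero).continuousOn
    refine ⟨M * C, fun n p hp => norm_mollify_le (fun q hq => ?_) n⟩
    rw [hW, norm_smul]
    have hq' : q ∈ closedBall (0 : ℝ × ℝ) (R + 1) := by
      rw [mem_closedBall] at *
      linarith [dist_triangle q p 0]
    have hMq : ‖w q‖ ≤ M := hM q
    exact mul_le_mul hMq (hC q hq') (norm_nonneg _) ((norm_nonneg _).trans hMq)
  have hVlim : ∀ᵐ p, Tendsto (fun n => V n p) atTop (𝓝 (W p)) := by
    -- Lebesgue differentiation needs the ratio of outer to inner radius bounded; for `bump` it is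
    -- exactly 2.
    refine ContDiffBump.ae_convolution_tendsto_right_of_locallyIntegrable (K := 2)
      (φ := bump) (l := atTop) ?_ (Eventually.of_forall fun n => ?_) hWl
    · exact tendsto_one_div_add_atTop_nhds_zero_nat
    · show 1 / ((n : ℝ) + 1) ≤ 2 * (1 / (2 * ((n : ℝ) + 1)))
      apply le_of_eq
      field_simp
  have hprim : ∀ n, ∃ f : ℝ × ℝ → ℝ, ∀ p, HasFDerivAt f (V n p) p := by
    intro n
    obtain ⟨f, hf⟩ := convex_univ.exists_forall_hasFDerivAt_of_fderiv_symmetric (𝕜 := ℝ) isOpen_univ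
      ((hVs n).differentiable one_ne_zero).differentiableOn
      (fun a _ x y => mollify_symm hψ hw hM h n a x y)
    exact ⟨f, fun p => hf p (mem_univ p)⟩
  choose f hf using hprim
  -- Normalising the primitives at the origin turns the uniform gradient bound into local
  -- boundedness.
  set F : ℕ → ℝ × ℝ → ℝ := fun n p => f n p - f n 0 with hFdef
  have hF : ∀ n p, HasFDerivAt (F n) (V n p) p := fun n p => (hf n p).sub_const _
  have hFd : ∀ n, fderiv ℝ (F n) = V n := fun n => funext fun p => (hF n p).fderiv
  have hF2 : ∀ n, ContDiff ℝ 2 (F n) := by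
    intro n
    rw [show (2 : ℕ∞ω) = 1 + 1 by norm_num, contDiff_succ_iff_fderiv, hFd]
    exact ⟨fun p => (hF n p).differentiableAt, by simp, hVs n⟩
  obtain ⟨κ, hκ, H, hH⟩ := exists_subseq_tendsto (F := F) (fun n => by simp [hFdef]) (by
    intro R
    obtain ⟨C, hC⟩ := hVb R
    exact ⟨C, fun n p hp q hq => abs_sub_le_of_fderiv_bound
      (fun x => (hF n x).differentiableAt) (fun x hx => by rw [hFd]; exact hC n x hx) hp hq⟩)
  refine ⟨H, fun n => F (κ n), fun n => hF2 _, hH, fun R => ?_, ?_⟩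
  · obtain ⟨C, hC⟩ := hVb R
    exact ⟨C, fun n p hp => by rw [hFd]; exact hC _ p hp⟩
  · filter_upwards [hVlim] with p hp
    simp_rw [hFd]
    exact hp.comp hκ.tendsto_atTop

theorem IsPotential.abs_sub_le {ψ w H : ℝ × ℝ → ℝ} {Hn : ℕ → ℝ × ℝ → ℝ}
    (h : IsPotential ψ w H Hn) (R : ℝ) : ∃ C : ℝ, ∀ p ∈ closedBall (0 : ℝ × ℝ) R,
      ∀ q ∈ closedBall (0 : ℝ × ℝ) R, |H p - H q| ≤ C * dist p q := by
  obtain ⟨C, hC⟩ := h.bound R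
  refine ⟨C, fun p hp q hq => ?_⟩
  refine le_of_tendsto ((h.tendsto p).sub (h.tendsto q)).abs (Eventually.of_forall fun n => ?_)
  exact abs_sub_le_of_fderiv_bound ((h.contDiff n).differentiable two_ne_zero) (hC n) hp hq

theorem IsPotential.continuous {ψ w H : ℝ × ℝ → ℝ} {Hn : ℕ → ℝ × ℝ → ℝ}
    (h : IsPotential ψ w H Hn) : Continuous H := by
  rw [continuous_iff_continuousAt]
  intro p
  obtain ⟨C, hC⟩ := h.abs_sub_le (‖p‖ + 1)
  have hL : LipschitzOnWith C.toNNReal H (closedBall 0 (‖p‖ + 1)) :=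
    LipschitzOnWith.of_dist_le' fun x hx y hy => hC x hx y hy
  refine hL.continuousOn.continuousAt ?_
  refine mem_of_superset (isOpen_ball.mem_nhds (?_ : p ∈ ball (0 : ℝ × ℝ) (‖p‖ + 1)))
    ball_subset_closedBall
  simp

/-- The integral of the bracket of two continuously differentiable functions vanishes if one of
them is compactly supported. -/
theorem integral_planarBracket_eq_zero_of_contDiff_one {ψ η : ℝ × ℝ → ℝ} (hψ : ContDiff ℝ 1 ψ)
    (hη : ContDiff ℝ 1 η) (hc : HasCompactSupport η) : ∫ p, planarBracket ψ η p = 0 := by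
  -- Neither function need be `C²`. The potential construction with weight 1 supplies `C²` functions
  -- whose gradients tend to that of `ψ` almost everywhere, and the identity passes to the limit.
  obtain ⟨H, Hn, hH⟩ := exists_isPotential (w := fun _ => 1) hψ measurable_const (M := 1) (by simp)
    fun φ hφ hφc => by
      simpa using integral_planarBracket_eq_zero hψ (contDiff_infty.1 hφ 2) (Or.inr hφc)
  have hz : ∀ n, ∫ p, planarBracket (Hn n) η p = 0 := by
    intro n
    simp_rw [planarBracket_swap (Hn n) η, integral_neg,
      integral_planarBracket_eq_zero hη (hH.contDiff n) (Or.inl hc), neg_zero]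
  obtain ⟨R, hR⟩ := hc.isCompact.isBounded.subset_closedBall 0
  obtain ⟨C, hC⟩ := hH.bound R
  set g : ℝ × ℝ → ℝ := fun p => C * ‖((1, 0) : ℝ × ℝ)‖ * |fderiv ℝ η p (0, 1)|
    + C * ‖((0, 1) : ℝ × ℝ)‖ * |fderiv ℝ η p (1, 0)|
  have hg : Integrable g := by
    have hi : ∀ v : ℝ × ℝ, Integrable fun p => |fderiv ℝ η p v| := fun v =>
      ((continuous_fderiv_apply_const hη v).integrable_of_hasCompactSupport
        (hc.fderiv_apply ℝ v)).abs
    exact ((hi _).const_mul _).add ((hi _).const_mul _)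
  have hlim : Tendsto (fun n => ∫ p, planarBracket (Hn n) η p) atTop
      (𝓝 (∫ p, planarBracket ψ η p)) := by
    refine tendsto_integral_of_dominated_convergence g
      (fun n => (continuous_planarBracket ((hH.contDiff n).of_le (by norm_num))
        hη).aestronglyMeasurable) hg (fun n => Eventually.of_forall fun p => ?_) ?_
    · by_cases hp : p ∈ tsupport η
      · have hb : ∀ v : ℝ × ℝ, |fderiv ℝ (Hn n) p v| ≤ C * ‖v‖ := fun v =>
          ((fderiv ℝ (Hn n) p).le_opNorm v).trans (by gcongr; exact hC n p (hR hp))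
        refine (norm_sub_le _ _).trans ?_
        rw [norm_mul, norm_mul]
        exact add_le_add (mul_le_mul_of_nonneg_right (hb _) (abs_nonneg _))
          (mul_le_mul_of_nonneg_right (hb _) (abs_nonneg _))
      · rw [planarBracket_eq_zero_of_notMem_tsupport hp, norm_zero]
        have : fderiv ℝ η p = 0 := by
          by_contra h
          exact hp (support_fderiv_subset ℝ h)
        simp [g, this]
    · filter_upwards [hH.tendsto_fderiv] with p hp
      rw [one_smul] at hp
      have hv : ∀ v : ℝ × ℝ, Tendsto (fun n => fderiv ℝ (Hn n) p v) atTop (𝓝 (fderiv ℝ ψ p v)) :=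
        fun v => ((ContinuousLinearMap.apply ℝ ℝ v).continuous.tendsto _).comp hp
      exact ((hv _).mul_const _).sub ((hv _).mul_const _)
  exact tendsto_nhds_unique hlim (by simp_rw [hz]; exact tendsto_const_nhds)

end StreamlineAveraging

end

noncomputable section

namespace StreamlineAveraging

open Filter Topology Set

/-! ### Straightening the level sets near regular points -/

/-- A chart `F` of an open set `B` onto a square, with inverse `Θ`, in which `ψ` is the second
coordinate. -/
structure IsFlowBox (ψ : ℝ × ℝ → ℝ) (B : Set (ℝ × ℝ)) (F Θ : ℝ × ℝ → ℝ × ℝ) (z₀ : ℝ × ℝ)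
    (r K : ℝ) : Prop where
  isOpen : IsOpen B
  pos : 0 < r
  mapsTo : ∀ p ∈ B, F p ∈ ball z₀ r
  mapsTo_symm : ∀ z ∈ ball z₀ r, Θ z ∈ B
  left_inv : ∀ p ∈ B, Θ (F p) = p
  right_inv : ∀ z ∈ ball z₀ r, F (Θ z) = z
  snd_eq : ∀ p, (F p).2 = ψ p
  differentiable : Differentiable ℝ F
  contDiffAt : ∀ z ∈ ball z₀ r, ContDiffAt ℝ 1 Θ z
  norm_le : ∀ z ∈ ball z₀ r, ‖Θ z‖ ≤ K
  norm_fderiv_le : ∀ z ∈ ball z₀ r, ‖fderiv ℝ Θ z‖ ≤ K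

theorem exists_isFlowBox {ψ : ℝ × ℝ → ℝ} (hψ : ContDiff ℝ 1 ψ) {p₀ : ℝ × ℝ}
    (h : fderiv ℝ ψ p₀ ≠ 0) : ∃ B F Θ z₀ r K, p₀ ∈ B ∧ IsFlowBox ψ B F Θ z₀ r K := by
  set a := fderiv ℝ ψ p₀ (1, 0) with ha
  set b := fderiv ℝ ψ p₀ (0, 1) with hb
  have hψ' : ∀ v, fderiv ℝ ψ p₀ v = v.1 * a + v.2 * b := by
    intro v
    have : v = v.1 • ((1, 0) : ℝ × ℝ) + v.2 • ((0, 1) : ℝ × ℝ) := by ext <;> simp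
    conv_lhs => rw [this, map_add, map_smul, map_smul]
    rfl
  have hd : a ^ 2 + b ^ 2 ≠ 0 := by
    intro h0
    have h1 : a = 0 := by nlinarith [sq_nonneg a, sq_nonneg b]
    have h2 : b = 0 := by nlinarith [sq_nonneg a, sq_nonneg b]
    exact h (ContinuousLinearMap.ext fun v => by rw [hψ', h1, h2]; simp)
  -- The linear form of the rotated gradient: the derivative of `(ℓ, ψ)` at `p₀` then has
  -- determinant `a ^ 2 + b ^ 2`.
  set ℓ : ℝ × ℝ →L[ℝ] ℝ := b • ContinuousLinearMap.fst ℝ ℝ ℝ - a • ContinuousLinearMap.snd ℝ ℝ ℝ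
    with hℓ
  have hℓv : ∀ v, ℓ v = b * v.1 - a * v.2 := fun v => by simp [hℓ]
  set F : ℝ × ℝ → ℝ × ℝ := fun p => (ℓ p, ψ p) with hF
  have hFc : ContDiff ℝ 1 F := ℓ.contDiff.prodMk hψ
  let inv : ℝ × ℝ →L[ℝ] ℝ × ℝ :=
    ((b / (a ^ 2 + b ^ 2)) • ContinuousLinearMap.fst ℝ ℝ ℝ
      + (a / (a ^ 2 + b ^ 2)) • ContinuousLinearMap.snd ℝ ℝ ℝ).prod
    ((-a / (a ^ 2 + b ^ 2)) • ContinuousLinearMap.fst ℝ ℝ ℝ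
      + (b / (a ^ 2 + b ^ 2)) • ContinuousLinearMap.snd ℝ ℝ ℝ)
  let A : (ℝ × ℝ) ≃L[ℝ] ℝ × ℝ := ContinuousLinearEquiv.equivOfInverse
    (ℓ.prod (fderiv ℝ ψ p₀)) inv
    (fun v => by
      simp only [ContinuousLinearMap.prod_apply, hψ', hℓv, inv]
      ext <;> simp <;> field_simp <;> ring)
    (fun v => by
      simp only [ContinuousLinearMap.prod_apply, hψ', hℓv, inv]
      ext <;> simp <;> field_simp <;> ring)
  have hA : HasFDerivAt F (A : ℝ × ℝ →L[ℝ] ℝ × ℝ) p₀ :=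
    ℓ.hasFDerivAt.prodMk (hψ.differentiable one_ne_zero p₀).hasFDerivAt
  set e := hFc.contDiffAt.toOpenPartialHomeomorph F hA one_ne_zero with he
  have heF : (e : ℝ × ℝ → ℝ × ℝ) = F := hFc.contDiffAt.toOpenPartialHomeomorph_coe hA one_ne_zero
  have hp₀ : p₀ ∈ e.source := hFc.contDiffAt.mem_toOpenPartialHomeomorph_source hA one_ne_zero
  have hΘ : ContDiffAt ℝ 1 e.symm (F p₀) := hFc.contDiffAt.to_localInverse hA one_ne_zero
  have h1 : ∀ᶠ z in 𝓝 (F p₀), z ∈ e.target :=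
    e.open_target.mem_nhds (heF ▸ e.map_source hp₀)
  have h2 : ∀ᶠ z in 𝓝 (F p₀), ContDiffAt ℝ 1 e.symm z := hΘ.eventually (by simp)
  have h3 : ∀ᶠ z in 𝓝 (F p₀), ‖e.symm z‖ < ‖e.symm (F p₀)‖ + 1 :=
    hΘ.continuousAt.norm.eventually_lt continuousAt_const (by simp)
  have h4 : ∀ᶠ z in 𝓝 (F p₀), ‖fderiv ℝ e.symm z‖ < ‖fderiv ℝ e.symm (F p₀)‖ + 1 :=
    (hΘ.continuousAt_fderiv one_ne_zero).norm.eventually_lt continuousAt_const (by simp)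
  obtain ⟨r, hr, hball⟩ := Metric.eventually_nhds_iff_ball.1 (h1.and (h2.and (h3.and h4)))
  refine ⟨e.source ∩ e ⁻¹' ball (F p₀) r, F, e.symm, F p₀, r,
    max (‖e.symm (F p₀)‖ + 1) (‖fderiv ℝ e.symm (F p₀)‖ + 1), ⟨hp₀, ?_⟩, ?_⟩
  · simp [heF, hr]
  constructor
  · exact e.isOpen_inter_preimage isOpen_ball
  · exact hr
  · intro p hp
    simpa [heF] using hp.2
  · intro z hz
    have := (hball z hz).1
    exact ⟨e.map_target this, by rw [mem_preimage, e.right_inv this]; exact hz⟩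
  · intro p hp
    rw [← heF, e.left_inv hp.1]
  · intro z hz
    rw [← heF, e.right_inv (hball z hz).1]
  · intro p; rfl
  · exact hFc.differentiable one_ne_zero
  · exact fun z hz => (hball z hz).2.1
  · exact fun z hz => (hball z hz).2.2.1.le.trans (le_max_left _ _)
  · exact fun z hz => (hball z hz).2.2.2.le.trans (le_max_right _ _)

section FlowBox

variable {ψ : ℝ × ℝ → ℝ} {B : Set (ℝ × ℝ)} {F Θ : ℝ × ℝ → ℝ × ℝ} {z₀ : ℝ × ℝ} {r K : ℝ}

/-- The set lies in `F '' Z`, and differentiable maps of the plane to itself preserve null sets. -/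
theorem IsFlowBox.volume_preimage_symm (h : IsFlowBox ψ B F Θ z₀ r K) {Z : Set (ℝ × ℝ)}
    (hZ : volume Z = 0) : volume (ball z₀ r ∩ Θ ⁻¹' Z) = 0 := by
  refine measure_mono_null ?_ (addHaar_image_eq_zero_of_differentiableOn_of_addHaar_eq_zero volume
    h.differentiable.differentiableOn hZ)
  rintro z ⟨hz, hz'⟩
  exact ⟨Θ z, hz', h.right_inv z hz⟩

theorem IsFlowBox.volume_preimage (h : IsFlowBox ψ B F Θ z₀ r K) {Z : Set (ℝ × ℝ)}
    (hZ : volume (ball z₀ r ∩ Z) = 0) : volume (B ∩ F ⁻¹' Z) = 0 := by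
  refine measure_mono_null ?_ (addHaar_image_eq_zero_of_differentiableOn_of_addHaar_eq_zero volume
    (f := Θ) (fun z hz => ((h.contDiffAt z hz.1).differentiableAt one_ne_zero).differentiableWithinAt)
    hZ)
  rintro p ⟨hp, hp'⟩
  exact ⟨F p, ⟨h.mapsTo p hp, hp'⟩, h.left_inv p hp⟩

theorem IsFlowBox.snd_eq_symm (h : IsFlowBox ψ B F Θ z₀ r K) {z : ℝ × ℝ} (hz : z ∈ ball z₀ r) :
    ψ (Θ z) = z.2 := by
  rw [← h.snd_eq, h.right_inv z hz]

theorem IsFlowBox.volume_inter_preimage (h : IsFlowBox ψ B F Θ z₀ r K) {N : Set ℝ}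
    (hN : volume N = 0) : volume (B ∩ ψ ⁻¹' N) = 0 := by
  have hs : volume (Prod.snd ⁻¹' N : Set (ℝ × ℝ)) = 0 :=
    Measure.quasiMeasurePreserving_snd.preimage_null hN
  have := h.volume_preimage (measure_mono_null inter_subset_right hs)
  refine measure_mono_null ?_ this
  rintro p ⟨hp, hp'⟩
  exact ⟨hp, by simpa [h.snd_eq] using hp'⟩

theorem IsFlowBox.continuousOn (h : IsFlowBox ψ B F Θ z₀ r K) : ContinuousOn Θ (ball z₀ r) :=
  fun z hz => (h.contDiffAt z hz).continuousAt.continuousWithinAt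

theorem IsFlowBox.fderiv_comp (h : IsFlowBox ψ B F Θ z₀ r K) (hψ : Differentiable ℝ ψ)
    {z : ℝ × ℝ} (hz : z ∈ ball z₀ r) (v : ℝ × ℝ) : fderiv ℝ ψ (Θ z) (fderiv ℝ Θ z v) = v.2 := by
  have h1 : HasFDerivAt (ψ ∘ Θ) ((fderiv ℝ ψ (Θ z)).comp (fderiv ℝ Θ z)) z :=
    (hψ _).hasFDerivAt.comp z ((h.contDiffAt z hz).differentiableAt one_ne_zero).hasFDerivAt
  have h2 : HasFDerivAt (ψ ∘ Θ) (ContinuousLinearMap.snd ℝ ℝ ℝ) z := by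
    refine hasFDerivAt_snd.congr_of_eventuallyEq ?_
    filter_upwards [isOpen_ball.mem_nhds hz] with y hy
    exact h.snd_eq_symm hy
  have := congrArg (fun L : ℝ × ℝ →L[ℝ] ℝ => L v) (h1.unique h2)
  simpa using this

/-- The increments of a potential along a segment in the straightened coordinates. -/
theorem IsFlowBox.potential_sub (h : IsFlowBox ψ B F Θ z₀ r K) (hψ : Differentiable ℝ ψ)
    {w H : ℝ × ℝ → ℝ} {Hn : ℕ → ℝ × ℝ → ℝ} (hH : IsPotential ψ w H Hn) {z v : ℝ × ℝ} {a b : ℝ}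
    (hseg : ∀ t ∈ uIcc a b, z + t • v ∈ ball z₀ r)
    (hlim : ∀ᵐ t : ℝ, t ∈ uIcc a b → Tendsto (fun n => fderiv ℝ (Hn n) (Θ (z + t • v))) atTop
      (𝓝 (w (Θ (z + t • v)) • fderiv ℝ ψ (Θ (z + t • v))))) :
    H (Θ (z + b • v)) - H (Θ (z + a • v)) = ∫ t in a..b, w (Θ (z + t • v)) * v.2 := by
  obtain ⟨C, hC⟩ := hH.bound K
  set d : ℕ → ℝ → ℝ := fun n t =>
    fderiv ℝ (Hn n) (Θ (z + t • v)) (fderiv ℝ Θ (z + t • v) v) with hd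
  have hder : ∀ n, ∀ t ∈ uIcc a b, HasDerivAt (fun t => Hn n (Θ (z + t • v))) (d n t) t := by
    intro n t ht
    have h1 : HasDerivAt (fun t : ℝ => z + t • v) v t := by
      simpa using ((hasDerivAt_id t).smul_const v).const_add z
    have h2 := ((h.contDiffAt _ (hseg t ht)).differentiableAt one_ne_zero).hasFDerivAt.comp_hasDerivAt
      t h1
    exact (((hH.contDiff n).differentiable two_ne_zero) _).hasFDerivAt.comp_hasDerivAt t h2
  have hcont : ∀ n, ContinuousOn (d n) (uIcc a b) := by
    intro n t ht
    have h1 : ContinuousAt (fun t : ℝ => z + t • v) t := by fun_prop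
    have h2 := h.contDiffAt _ (hseg t ht)
    have h3 : ContinuousAt (fun t : ℝ => fderiv ℝ Θ (z + t • v)) t :=
      ContinuousAt.comp (f := fun t : ℝ => z + t • v) (g := fderiv ℝ Θ)
        (h2.continuousAt_fderiv one_ne_zero) h1
    have h4 : ContinuousAt (fun t : ℝ => Θ (z + t • v)) t :=
      ContinuousAt.comp (f := fun t : ℝ => z + t • v) (g := Θ) h2.continuousAt h1
    have h5 : ContinuousAt (fun t : ℝ => fderiv ℝ (Hn n) (Θ (z + t • v))) t :=
      ContinuousAt.comp (f := fun t : ℝ => Θ (z + t • v)) (g := fderiv ℝ (Hn n))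
        ((hH.contDiff n).continuous_fderiv two_ne_zero).continuousAt h4
    exact (h5.clm_apply (h3.clm_apply continuousAt_const)).continuousWithinAt
  have hint : ∀ n, ∫ t in a..b, d n t = Hn n (Θ (z + b • v)) - Hn n (Θ (z + a • v)) := fun n =>
    intervalIntegral.integral_eq_sub_of_hasDerivAt (hder n) (hcont n).intervalIntegrable
  -- Since `ψ ∘ Θ` is the second coordinate, the limiting derivative along `v` is `w * v.2`: zero
  -- horizontally and `w` vertically.
  have hlim1 : Tendsto (fun n => ∫ t in a..b, d n t) atTop
      (𝓝 (∫ t in a..b, w (Θ (z + t • v)) * v.2)) := by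
    refine intervalIntegral.tendsto_integral_filter_of_dominated_convergence
      (fun _ => C * (K * ‖v‖)) (Eventually.of_forall fun n => ?_)
      (Eventually.of_forall fun n => Eventually.of_forall fun t ht => ?_)
      intervalIntegrable_const ?_
    · exact ((hcont n).mono uIoc_subset_uIcc).aestronglyMeasurable measurableSet_uIoc
    · have hz := hseg t (uIoc_subset_uIcc ht)
      have hb : Θ (z + t • v) ∈ closedBall (0 : ℝ × ℝ) K := by simpa using h.norm_le _ hz
      refine ((fderiv ℝ (Hn n) _).le_opNorm _).trans ?_
      refine mul_le_mul (hC n _ hb) ?_ (norm_nonneg _) ((norm_nonneg _).trans (hC n _ hb))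
      refine ((fderiv ℝ Θ _).le_opNorm _).trans ?_
      exact mul_le_mul_of_nonneg_right (h.norm_fderiv_le _ hz) (norm_nonneg _)
    · filter_upwards [hlim] with t ht ht'
      have ht'' := uIoc_subset_uIcc ht'
      have := ((ContinuousLinearMap.apply ℝ ℝ (fderiv ℝ Θ (z + t • v) v)).continuous.tendsto _).comp
        (ht ht'')
      simpa [Function.comp_def, h.fderiv_comp hψ (hseg t ht'')] using this
  have hlim2 : Tendsto (fun n => ∫ t in a..b, d n t) atTop
      (𝓝 (H (Θ (z + b • v)) - H (Θ (z + a • v)))) := by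
    simp_rw [hint]
    exact (hH.tendsto _).sub (hH.tendsto _)
  exact tendsto_nhds_unique hlim2 hlim1

end FlowBox

end StreamlineAveraging

end

noncomputable section

namespace StreamlineAveraging

open Filter Topology Set

/-! ### Local factorisation of a potential through the stream function. -/

theorem mem_ball_prod_iff {z z₀ : ℝ × ℝ} {r : ℝ} :
    z ∈ ball z₀ r ↔ z.1 ∈ ball z₀.1 r ∧ z.2 ∈ ball z₀.2 r := by
  rw [← mem_prod, ball_prod_same]

/-- Near a regular point, a potential of `w ∇ψ` is a function `G` of `ψ`, and `w` is the derivative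
of `G` at `ψ`. -/
theorem IsPotential.exists_local_factor {ψ w H : ℝ × ℝ → ℝ} {Hn : ℕ → ℝ × ℝ → ℝ}
    (hH : IsPotential ψ w H Hn) (hψ : ContDiff ℝ 1 ψ) (hw : Measurable w) {M : ℝ}
    (hM : ∀ p, |w p| ≤ M) {p₀ : ℝ × ℝ} (hp₀ : fderiv ℝ ψ p₀ ≠ 0) :
    ∃ B, IsOpen B ∧ p₀ ∈ B ∧ ∃ G : ℝ → ℝ, (∀ p ∈ B, H p = G (ψ p)) ∧
      (∀ᵐ p, p ∈ B → HasDerivAt G (w p) (ψ p)) ∧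
      ∀ᵐ c, c ∈ ψ '' B → DifferentiableAt ℝ G c := by
  obtain ⟨B, F, Θ, z₀, r, K, hpB, h⟩ := exists_isFlowBox hψ hp₀
  have hψd := hψ.differentiable one_ne_zero
  set Z : Set (ℝ × ℝ) :=
    {p | ¬ Tendsto (fun n => fderiv ℝ (Hn n) p) atTop (𝓝 (w p • fderiv ℝ ψ p))} with hZ
  have hZ0 : volume Z = 0 := hH.tendsto_fderiv
  have hgood : ∀ᵐ z : ℝ × ℝ, z ∈ ball z₀ r → Θ z ∉ Z := by
    have := h.volume_preimage_symm hZ0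
    rw [ae_iff]
    convert this using 2
    ext z
    simp
  have hHΘ : ContinuousOn (fun z => H (Θ z)) (ball z₀ r) := hH.continuous.comp_continuousOn h.continuousOn
  -- along almost every vertical segment
  have hvert : ∀ᵐ s : ℝ, s ∈ ball z₀.1 r → ∀ a ∈ ball z₀.2 r, ∀ b ∈ ball z₀.2 r,
      H (Θ (s, b)) - H (Θ (s, a)) = ∫ t in a..b, w (Θ (s, t)) := by
    filter_upwards [Measure.ae_ae_of_ae_prod hgood] with s hs hsr a ha b hb
    have hsub : ∀ t ∈ uIcc a b, t ∈ ball z₀.2 r := fun t ht => by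
      have := (convex_ball z₀.2 r).segment_subset ha hb
      rw [segment_eq_uIcc] at this
      exact this ht
    have key := h.potential_sub hψd hH (z := (s, 0)) (v := (0, 1)) (a := a) (b := b)
      (fun t ht => by simpa using mem_ball_prod_iff.2 ⟨hsr, hsub t ht⟩) (by
        filter_upwards [hs] with t ht htu
        have := ht (mem_ball_prod_iff.2 ⟨hsr, hsub t htu⟩)
        simpa [hZ] using this)
    simpa using key
  -- along every horizontal segment
  have hhor : ∀ t ∈ ball z₀.2 r, ∀ a ∈ ball z₀.1 r, ∀ b ∈ ball z₀.1 r,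
      H (Θ (a, t)) = H (Θ (b, t)) := by
    have hae : ∀ᵐ t : ℝ, t ∈ ball z₀.2 r → ∀ a ∈ ball z₀.1 r, ∀ b ∈ ball z₀.1 r,
        H (Θ (a, t)) = H (Θ (b, t)) := by
      have hswap : ∀ᵐ z : ℝ × ℝ, z.swap ∈ ball z₀ r → Θ z.swap ∉ Z :=
        (Measure.measurePreserving_swap (μ := (volume : Measure ℝ))
          (ν := (volume : Measure ℝ))).quasiMeasurePreserving.ae hgood
      filter_upwards [Measure.ae_ae_of_ae_prod hswap] with t ht htr a ha b hb
      have hsub : ∀ s ∈ uIcc b a, s ∈ ball z₀.1 r := fun s hs => by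
        have := (convex_ball z₀.1 r).segment_subset hb ha
        rw [segment_eq_uIcc] at this
        exact this hs
      have key := h.potential_sub hψd hH (z := (0, t)) (v := (1, 0)) (a := b) (b := a)
        (fun s hs => by simpa using mem_ball_prod_iff.2 ⟨hsub s hs, htr⟩) (by
          filter_upwards [ht] with s hs hsu
          have := hs (mem_ball_prod_iff.2 ⟨hsub s hsu, htr⟩)
          simpa [hZ] using this)
      simp only [Prod.smul_mk, smul_eq_mul, mul_one, mul_zero, Prod.mk_add_mk, zero_add, add_zero,
        intervalIntegral.integral_zero] at key
      exact sub_eq_zero.1 key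
    intro t ht a ha b hb
    -- Fubini gives the identity only at almost every height; such heights are dense, and continuity
    -- of `H ∘ Θ` gives the rest.
    have hcl : t ∈ closure {t | t ∈ ball z₀.2 r ∧ H (Θ (a, t)) = H (Θ (b, t))} := by
      rw [_root_.mem_closure_iff]
      intro o ho hto
      have hpos : 0 < volume (o ∩ ball z₀.2 r) :=
        (ho.inter isOpen_ball).measure_pos volume ⟨t, hto, ht⟩
      obtain ⟨t', ht', ht''⟩ := ((frequently_ae_mem_iff.2 hpos.ne').and_eventually hae).exists
      exact ⟨t', ht'.1, ht'.2, ht'' ht'.2 a ha b hb⟩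
    have hc : ∀ s ∈ ball z₀.1 r, ContinuousOn (fun t => H (Θ (s, t))) (ball z₀.2 r) := fun s hs =>
      hHΘ.comp (by fun_prop) fun t ht => mem_ball_prod_iff.2 ⟨hs, ht⟩
    have hclosed := ((hc a ha).sub (hc b hb)).continuousAt (isOpen_ball.mem_nhds ht)
    have hfreq := mem_closure_iff_frequently.1 hcl
    have : (fun t => H (Θ (a, t)) - H (Θ (b, t))) t ∈ closure ({0} : Set ℝ) := by
      rw [mem_closure_iff_frequently]
      refine hclosed.tendsto.frequently (hfreq.mono fun t' ht' => ?_)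
      simpa [sub_eq_zero] using ht'.2
    simpa [sub_eq_zero] using this
  set G : ℝ → ℝ := fun t => H (Θ (z₀.1, t)) with hG
  have hG' : ∀ z ∈ ball z₀ r, H (Θ z) = G z.2 := by
    intro z hz
    rw [mem_ball_prod_iff] at hz
    exact hhor z.2 hz.2 z.1 hz.1 z₀.1 (mem_ball_self h.pos)
  classical
  -- `Θ` is controlled only on the ball; a constant outside it keeps the composition measurable on
  -- the whole plane.
  set wQ : ℝ × ℝ → ℝ := fun z => w ((ball z₀ r).piecewise Θ (fun _ => 0) z) with hwQ
  have hwQm : Measurable wQ := hw.comp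
    (h.continuousOn.measurable_piecewise continuousOn_const isOpen_ball.measurableSet)
  have hwQeq : ∀ z ∈ ball z₀ r, wQ z = w (Θ z) := fun z hz => by simp [hwQ, hz]
  have hder : ∀ᵐ s : ℝ, s ∈ ball z₀.1 r → ∀ᵐ t : ℝ, t ∈ ball z₀.2 r → HasDerivAt G (wQ (s, t)) t := by
    filter_upwards [hvert] with s hs hsr
    have hli : LocallyIntegrable (fun t => wQ (s, t)) := by
      refine (continuous_const (y := M)).locallyIntegrable.mono
        (hwQm.comp measurable_prodMk_left).aestronglyMeasurable (Eventually.of_forall fun t => ?_)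
      exact (hM _).trans (le_abs_self M)
    filter_upwards [_root_.LocallyIntegrable.ae_hasDerivAt_integral hli] with t ht htr
    have h1 := (ht z₀.2).const_add (G z₀.2)
    refine h1.congr_of_eventuallyEq ?_
    filter_upwards [isOpen_ball.mem_nhds htr] with t' ht'
    have h2 := hs hsr z₀.2 (mem_ball_self h.pos) t' ht'
    rw [hG' (s, t') (mem_ball_prod_iff.2 ⟨hsr, ht'⟩),
      hG' (s, z₀.2) (mem_ball_prod_iff.2 ⟨hsr, mem_ball_self h.pos⟩)] at h2
    have h3 : ∫ t in z₀.2..t', w (Θ (s, t)) = ∫ t in z₀.2..t', wQ (s, t) := by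
      refine intervalIntegral.integral_congr fun t'' ht'' => ?_
      have := (convex_ball z₀.2 r).segment_subset (mem_ball_self h.pos) ht'
      rw [segment_eq_uIcc] at this
      exact (hwQeq (s, t'') (mem_ball_prod_iff.2 ⟨hsr, this ht''⟩)).symm
    rw [← h3, ← h2]
    simp
  have hQ : ∀ᵐ z : ℝ × ℝ, z ∈ ball z₀ r → DifferentiableAt ℝ G z.2 ∧ deriv G z.2 = wQ z := by
    -- Passing from almost every `t` on almost every line to almost every `z` needs a measurable
    -- set, hence the formulation with `deriv` and `DifferentiableAt`.
    have hmeas : MeasurableSet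
        {z : ℝ × ℝ | z ∈ ball z₀ r → DifferentiableAt ℝ G z.2 ∧ deriv G z.2 = wQ z} := by
      refine MeasurableSet.imp isOpen_ball.measurableSet (MeasurableSet.inter ?_ ?_)
      · exact measurable_snd (measurableSet_of_differentiableAt ℝ G)
      · exact measurableSet_eq_fun ((measurable_deriv G).comp measurable_snd) hwQm
    refine (Measure.ae_prod_iff_ae_ae hmeas).2 ?_
    filter_upwards [hder] with s hs
    by_cases hsr : s ∈ ball z₀.1 r
    · filter_upwards [hs hsr] with t ht htz
      have := ht (mem_ball_prod_iff.1 htz).2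
      exact ⟨this.differentiableAt, this.deriv⟩
    · exact Eventually.of_forall fun t ht => absurd (mem_ball_prod_iff.1 ht).1 hsr
  refine ⟨B, h.isOpen, hpB, G, fun p hp => ?_, ?_, ?_⟩
  · rw [← h.snd_eq, ← hG' _ (h.mapsTo p hp), h.left_inv p hp]
  · have hnull : volume (ball z₀ r ∩ {z | ¬ (DifferentiableAt ℝ G z.2 ∧ deriv G z.2 = wQ z)}) = 0 := by
      rw [ae_iff] at hQ
      convert hQ using 2
      ext z
      simp
    have := h.volume_preimage hnull
    rw [ae_iff]
    refine measure_mono_null ?_ this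
    intro p hp
    simp only [mem_ofPred_eq, Classical.not_imp] at hp
    refine ⟨hp.1, fun hd => hp.2 ?_⟩
    have := hd.1.hasDerivAt
    rwa [hd.2, hwQeq _ (h.mapsTo p hp.1), h.left_inv p hp.1, h.snd_eq] at this
  · have hpos : 0 < volume (ball z₀.1 r) := isOpen_ball.measure_pos volume ⟨_, mem_ball_self h.pos⟩
    obtain ⟨s, hs, hs'⟩ := ((frequently_ae_mem_iff.2 hpos.ne').and_eventually hder).exists
    filter_upwards [hs' hs] with c hc
    rintro ⟨p, hp, rfl⟩
    have := mem_ball_prod_iff.1 (h.mapsTo p hp)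
    rw [h.snd_eq] at this
    exact (hc this.2).differentiableAt

/-! ### Null sets of values, critical levels and the countable factorisation. -/

/-- The points of a null set of values are taken on a null set of regular points. -/
theorem volume_regular_inter_preimage {ψ : ℝ × ℝ → ℝ} (hψ : ContDiff ℝ 1 ψ) {N : Set ℝ}
    (hN : volume N = 0) : volume ({p | fderiv ℝ ψ p ≠ 0} ∩ ψ ⁻¹' N) = 0 := by
  refine measure_null_of_locally_null _ fun p hp => ?_
  obtain ⟨B, F, Θ, z₀, r, K, hpB, h⟩ := exists_isFlowBox hψ hp.1
  refine ⟨B ∩ ψ ⁻¹' N, ?_, h.volume_inter_preimage hN⟩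
  have := inter_mem_nhdsWithin ({p | fderiv ℝ ψ p ≠ 0} ∩ ψ ⁻¹' N) (h.isOpen.mem_nhds hpB)
  exact mem_of_superset this fun q hq => ⟨hq.2, hq.1.2⟩

theorem volume_preimage_eq_zero {ψ : ℝ × ℝ → ℝ} (hψ : ContDiff ℝ 1 ψ)
    (hcrit : volume {p | fderiv ℝ ψ p = 0} = 0) {N : Set ℝ} (hN : volume N = 0) :
    volume (ψ ⁻¹' N) = 0 := by
  refine measure_mono_null ?_ (measure_union_null hcrit (volume_regular_inter_preimage hψ hN))
  intro p hp
  by_cases h : fderiv ℝ ψ p = 0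
  · exact Or.inl h
  · exact Or.inr ⟨h, hp⟩

theorem exists_lipschitzOnWith_closedBall {ψ : ℝ × ℝ → ℝ} (hψ : ContDiff ℝ 1 ψ) (R : ℝ) :
    ∃ C : NNReal, LipschitzOnWith C ψ (closedBall 0 R) := by
  obtain ⟨C, hC⟩ := (isCompact_closedBall (0 : ℝ × ℝ) R).exists_bound_of_continuousOn
    (hψ.continuous_fderiv one_ne_zero).continuousOn
  exact ⟨C.toNNReal, LipschitzOnWith.of_dist_le' fun x hx y hy =>
    abs_sub_le_of_fderiv_bound (hψ.differentiable one_ne_zero) hC hx hy⟩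

/-- For almost every value `c`, a potential maps the critical points of `ψ` at level `c` to a null
set. -/
theorem IsPotential.ae_volume_image_critical {ψ w H : ℝ × ℝ → ℝ} {Hn : ℕ → ℝ × ℝ → ℝ}
    (hH : IsPotential ψ w H Hn) (hψ : ContDiff ℝ 1 ψ)
    (hcrit : volume {p | fderiv ℝ ψ p = 0} = 0) :
    ∀ᵐ c, volume (H '' ({p | fderiv ℝ ψ p = 0} ∩ ψ ⁻¹' {c})) = 0 := by
  set S := {p | fderiv ℝ ψ p = 0}
  -- The null critical set stands in for Sard's theorem: a locally Lipschitz map of the plane to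
  -- itself preserves sets of zero two-dimensional measure. The slices are then handled by Fubini.
  have himg : volume ((fun p => (ψ p, H p)) '' S) = 0 := by
    have hU : S = ⋃ n : ℕ, S ∩ closedBall 0 n := by
      rw [← inter_iUnion, iUnion_closedBall_nat, inter_univ]
    rw [hU, image_iUnion, measure_iUnion_null_iff]
    intro n
    obtain ⟨C, hC⟩ := exists_lipschitzOnWith_closedBall hψ n
    obtain ⟨C', hC'⟩ := hH.abs_sub_le n
    have hL : LipschitzOnWith (max C C'.toNNReal) (fun p => (ψ p, H p)) (S ∩ closedBall 0 n) :=
      (hC.prodMk (LipschitzOnWith.of_dist_le' fun x hx y hy => hC' x hx y hy)).mono inter_subset_right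
    rw [← hausdorffMeasure_prod_real, ← nonpos_iff_eq_zero]
    refine (hL.hausdorffMeasure_image_le zero_le_two).trans ?_
    rw [hausdorffMeasure_prod_real, measure_mono_null inter_subset_left hcrit, mul_zero]
  filter_upwards [Measure.measure_ae_null_of_prod_null himg] with c hc
  refine measure_mono_null ?_ hc
  rintro _ ⟨p, ⟨hp, rfl⟩, rfl⟩
  exact ⟨p, hp, rfl⟩

/-- A countable family of local factorisations of a potential through `ψ`, with the properties
needed to compare them along the level sets of `ψ`. -/
theorem exists_potential_factorization {ψ w : ℝ × ℝ → ℝ} (hψ : ContDiff ℝ 1 ψ)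
    (hcrit : volume {p | fderiv ℝ ψ p = 0} = 0) (hw : Measurable w) {M : ℝ}
    (hM : ∀ p, |w p| ≤ M)
    (h : ∀ φ : ℝ × ℝ → ℝ, ContDiff ℝ ∞ φ → HasCompactSupport φ →
      ∫ p, w p * planarBracket ψ φ p = 0) :
    ∃ H : ℝ × ℝ → ℝ, Continuous H ∧ (∀ᵐ c, volume (H '' (ψ ⁻¹' {c})) = 0) ∧
      ∃ (ι : Type) (_ : Countable ι) (B : ι → Set (ℝ × ℝ)) (G : ι → ℝ → ℝ),
        (∀ i, ∀ p ∈ B i, H p = G i (ψ p)) ∧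
        (∀ᵐ p, ∃ i, p ∈ B i ∧ HasDerivAt (G i) (w p) (ψ p)) ∧
        ∀ᵐ c, ∀ i, c ∈ ψ '' B i → DifferentiableAt ℝ (G i) c := by
  obtain ⟨H, Hn, hH⟩ := exists_isPotential hψ hw hM h
  have hloc : ∀ p : {p | fderiv ℝ ψ p ≠ 0}, ∃ B, IsOpen B ∧ p.1 ∈ B ∧ ∃ G : ℝ → ℝ,
      (∀ p ∈ B, H p = G (ψ p)) ∧ (∀ᵐ p, p ∈ B → HasDerivAt G (w p) (ψ p)) ∧
      ∀ᵐ c, c ∈ ψ '' B → DifferentiableAt ℝ G c := fun p =>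
    hH.exists_local_factor hψ hw hM p.2
  choose B hBo hpB G hG1 hG2 hG3 using hloc
  obtain ⟨T, hT, hTB⟩ := TopologicalSpace.isOpen_iUnion_countable B hBo
  have : Countable T := hT
  have hcov : ∀ p, fderiv ℝ ψ p ≠ 0 → ∃ i : T, p ∈ B i := by
    intro p hp
    have : p ∈ ⋃ i, B i := mem_iUnion.2 ⟨⟨p, hp⟩, hpB ⟨p, hp⟩⟩
    rw [← hTB] at this
    simp only [mem_iUnion] at this
    obtain ⟨i, hi, hpi⟩ := this
    exact ⟨⟨i, hi⟩, hpi⟩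
  refine ⟨H, hH.continuous, ?_, T, hT, fun i => B i, fun i => G i, fun i => hG1 i, ?_, ?_⟩
  · filter_upwards [hH.ae_volume_image_critical hψ hcrit] with c hc
    -- At level `c` the regular points give at most one value `G i c` for each of countably many
    -- boxes.
    refine measure_mono_null ?_ (measure_union_null hc
      ((countable_range fun i : T => G i c).measure_zero volume))
    rintro _ ⟨p, rfl, rfl⟩
    by_cases hp : fderiv ℝ ψ p = 0
    · exact Or.inl ⟨p, ⟨hp, rfl⟩, rfl⟩
    · obtain ⟨i, hi⟩ := hcov p hp
      exact Or.inr ⟨i, (hG1 i p hi).symm⟩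
  · have hreg : ∀ᵐ p, fderiv ℝ ψ p ≠ 0 := by
      rw [ae_iff]
      simpa using hcrit
    filter_upwards [hreg, ae_all_iff.2 fun i : T => hG2 i] with p hp hp'
    obtain ⟨i, hi⟩ := hcov p hp
    exact ⟨i, hi, hp' i hi⟩
  · exact ae_all_iff.2 fun i : T => hG3 i

end StreamlineAveraging

end

noncomputable section

namespace StreamlineAveraging

open Filter Topology Set

/-! ### The stereographic parametrisation of the sphere -/

/-- The unnormalised stereographic parametrisation. -/
def stereoVec (p : ℝ × ℝ) : E3 := !₂[2 * p.1, 2 * p.2, 1 - p.1 ^ 2 - p.2 ^ 2]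

/-- The conformal denominator of the stereographic parametrisation. -/
def stereoDen (p : ℝ × ℝ) : ℝ := 1 + p.1 ^ 2 + p.2 ^ 2

theorem stereoDen_pos (p : ℝ × ℝ) : 0 < stereoDen p := by unfold stereoDen; positivity

theorem norm_stereoVec (p : ℝ × ℝ) : ‖stereoVec p‖ = stereoDen p := by
  rw [EuclideanSpace.norm_eq, Real.sqrt_eq_iff_mul_self_eq (by positivity) (stereoDen_pos p).le]
  simp [stereoVec, stereoDen, Fin.sum_univ_three]
  ring

theorem stereoVec_ne_zero (p : ℝ × ℝ) : stereoVec p ≠ 0 := by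
  rw [← norm_ne_zero_iff, norm_stereoVec]
  exact (stereoDen_pos p).ne'

/-- The stereographic parametrisation of the sphere without the south pole. -/
def stereo (p : ℝ × ℝ) : S2 := ⟨‖stereoVec p‖⁻¹ • stereoVec p, normalize_mem_sphere (stereoVec_ne_zero p)⟩

theorem coe_stereo (p : ℝ × ℝ) : (stereo p : E3) = (stereoDen p)⁻¹ • stereoVec p := by
  simp only [stereo, norm_stereoVec]

/-- The south pole. -/
def southPole : S2 := ⟨!₂[0, 0, -1], by
  rw [mem_sphere_zero_iff_norm, EuclideanSpace.norm_eq]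
  simp [Fin.sum_univ_three]⟩

/-- The stereographic projection from the south pole. -/
def stereoProj (x : S2) : ℝ × ℝ := (x.1 0 / (1 + x.1 2), x.1 1 / (1 + x.1 2))

theorem sphere_sum_sq (x : S2) : x.1 0 ^ 2 + x.1 1 ^ 2 + x.1 2 ^ 2 = 1 := by
  have h := x.2
  rw [mem_sphere_zero_iff_norm, EuclideanSpace.norm_eq, Real.sqrt_eq_one] at h
  simpa [Fin.sum_univ_three] using h

theorem one_add_ne_zero_of_ne_southPole {x : S2} (hx : x ≠ southPole) : 1 + x.1 2 ≠ 0 := by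
  intro h
  have h2 : x.1 2 = -1 := by linarith
  have hs := sphere_sum_sq x
  rw [h2] at hs
  have h0 : x.1 0 = 0 := by nlinarith [sq_nonneg (x.1 0), sq_nonneg (x.1 1)]
  have h1 : x.1 1 = 0 := by nlinarith [sq_nonneg (x.1 0), sq_nonneg (x.1 1)]
  apply hx
  ext i
  fin_cases i <;> simp [southPole, h0, h1, h2]

theorem stereo_stereoProj {x : S2} (hx : x ≠ southPole) : stereo (stereoProj x) = x := by
  have h := one_add_ne_zero_of_ne_southPole hx
  have hs := sphere_sum_sq x
  have hd : stereoDen (stereoProj x) = 2 / (1 + x.1 2) := by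
    simp only [stereoDen, stereoProj]
    field_simp
    linarith
  apply Subtype.ext
  rw [coe_stereo, hd]
  ext i
  fin_cases i
  · simp [stereoVec, stereoProj]; field_simp
  · simp [stereoVec, stereoProj]; field_simp
  · simp [stereoVec, stereoProj]; field_simp; linarith

theorem one_add_stereo (p : ℝ × ℝ) : 1 + (stereo p).1 2 = 2 / stereoDen p := by
  have := (stereoDen_pos p).ne'
  rw [coe_stereo]
  simp [stereoVec]
  field_simp
  simp only [stereoDen]; ring

theorem stereo_ne_southPole (p : ℝ × ℝ) : stereo p ≠ southPole := by
  intro h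
  have h1 := one_add_stereo p
  rw [h] at h1
  have := stereoDen_pos p
  have h2 : 0 < 2 / stereoDen p := by positivity
  simp [southPole] at h1
  linarith

theorem stereoProj_stereo (p : ℝ × ℝ) : stereoProj (stereo p) = p := by
  have := (stereoDen_pos p).ne'
  unfold stereoProj
  rw [one_add_stereo, coe_stereo]
  ext <;> simp [stereoVec] <;> field_simp

theorem stereo_injective : Function.Injective stereo :=
  Function.LeftInverse.injective stereoProj_stereo

theorem contDiff_stereoVec {n : ℕ∞ω} : ContDiff ℝ n stereoVec := by
  rw [contDiff_euclidean]
  intro i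
  fin_cases i <;> simp [stereoVec] <;> fun_prop

theorem continuous_stereo : Continuous stereo := by
  refine Continuous.subtype_mk ?_ _
  have h : Continuous stereoVec := (contDiff_stereoVec (n := 0)).continuous
  exact (h.norm.inv₀ fun p => norm_ne_zero_iff.2 (stereoVec_ne_zero p)).smul h

theorem continuousOn_stereoProj : ContinuousOn stereoProj {southPole}ᶜ := by
  have hc : ∀ i, Continuous fun x : S2 => x.1 i := fun i => by fun_prop
  exact ((hc 0).continuousOn.div (continuous_const.add (hc 2)).continuousOn
    fun x hx => one_add_ne_zero_of_ne_southPole hx).prodMk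
    ((hc 1).continuousOn.div (continuous_const.add (hc 2)).continuousOn
    fun x hx => one_add_ne_zero_of_ne_southPole hx)

theorem measurableEmbedding_stereo : MeasurableEmbedding stereo :=
  continuous_stereo.measurableEmbedding stereo_injective

/-! ### Radial extensions -/

theorem radialExtension_of_ne {f : S2 → ℝ} {y : E3} (hy : y ≠ 0) :
    radialExtension f y = f ⟨‖y‖⁻¹ • y, normalize_mem_sphere hy⟩ := dif_neg hy

theorem radialExtension_stereoVec (f : S2 → ℝ) (p : ℝ × ℝ) :
    radialExtension f (stereoVec p) = f (stereo p) := radialExtension_of_ne (stereoVec_ne_zero p)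

theorem radialExtension_smul (f : S2 → ℝ) {c : ℝ} (hc : 0 < c) (y : E3) :
    radialExtension f (c • y) = radialExtension f y := by
  by_cases hy : y = 0
  · simp [hy]
  · rw [radialExtension_of_ne hy, radialExtension_of_ne (smul_ne_zero hc.ne' hy)]
    congr 2
    rw [norm_smul, Real.norm_of_nonneg hc.le, mul_inv, smul_smul]
    congr 1
    field_simp

/-- Off the origin the extension is `f` composed with the smooth map `y ↦ ‖y‖⁻¹ • y` onto the
sphere. -/
theorem contDiffAt_radialExtension {n : ℕ∞ω} {f : S2 → ℝ} (hf : ContMDiff (𝓡 2) 𝓘(ℝ, ℝ) n f) {y : E3}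
    (hy : y ≠ 0) : ContDiffAt ℝ n (radialExtension f) y := by
  have : Fact (Module.finrank ℝ E3 = 2 + 1) := ⟨by simp⟩
  let U : TopologicalSpace.Opens E3 := ⟨{0}ᶜ, isOpen_compl_singleton⟩
  have h1 : ContMDiff 𝓘(ℝ, E3) 𝓘(ℝ, E3) n fun z : U => ‖(z : E3)‖⁻¹ • (z : E3) := by
    intro z
    have hz : (z : E3) ≠ 0 := z.2
    have : ContDiffAt ℝ n (fun z : E3 => ‖z‖⁻¹ • z) z :=
      ((contDiffAt_norm ℝ hz).inv (norm_ne_zero_iff.2 hz)).smul contDiffAt_id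
    exact (contMDiffAt_subtype_iff (U := U) (f := fun z : E3 => ‖z‖⁻¹ • z)).2 this.contMDiffAt
  have h2 := hf.comp (h1.codRestrict_sphere (fun z => normalize_mem_sphere z.2))
  have h3 : ContMDiffAt 𝓘(ℝ, E3) 𝓘(ℝ, ℝ) n (fun z : U => radialExtension f z) ⟨y, hy⟩ := by
    refine (h2 ⟨y, hy⟩).congr_of_eventuallyEq (Eventually.of_forall fun z => ?_)
    exact radialExtension_of_ne z.2
  exact contMDiffAt_iff_contDiffAt.1 ((contMDiffAt_subtype_iff (U := U)).1 h3)

theorem contDiff_comp_stereo {n : ℕ∞ω} {f : S2 → ℝ} (hf : ContMDiff (𝓡 2) 𝓘(ℝ, ℝ) n f) :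
    ContDiff ℝ n (f ∘ stereo) := by
  rw [show f ∘ stereo = radialExtension f ∘ stereoVec from
    funext fun p => (radialExtension_stereoVec f p).symm]
  exact contDiff_iff_contDiffAt.2 fun p =>
    (contDiffAt_radialExtension hf (stereoVec_ne_zero p)).comp p contDiff_stereoVec.contDiffAt

theorem fderiv_radialExtension_smul (f : S2 → ℝ) {c : ℝ} (hc : 0 < c) (y : E3) :
    fderiv ℝ (radialExtension f) y = c • fderiv ℝ (radialExtension f) (c • y) := by
  rw [← fderiv_comp_smul]
  simp_rw [radialExtension_smul f hc]

theorem inner_surfaceGradient (f : S2 → ℝ) (x : S2) (v : E3) :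
    inner ℝ (surfaceGradient f x) v = fderiv ℝ (radialExtension f) x v := by
  simp [surfaceGradient, gradient]

theorem coe_ne_zero (x : S2) : (x : E3) ≠ 0 := ne_zero_of_mem_unit_sphere x

theorem inner_surfaceGradient_self {f : S2 → ℝ} (hf : ContMDiff (𝓡 2) 𝓘(ℝ, ℝ) 1 f) (x : S2) :
    inner ℝ (surfaceGradient f x) (x : E3) = 0 := by
  rw [inner_surfaceGradient]
  have hd := ((contDiffAt_radialExtension hf (coe_ne_zero x)).differentiableAt
    one_ne_zero).hasFDerivAt
  have h1 : HasDerivAt (fun t : ℝ => t • (x : E3)) (x : E3) 1 := by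
    simpa using (hasDerivAt_id (1 : ℝ)).smul_const (x : E3)
  have h2 : HasDerivAt (fun t : ℝ => radialExtension f (t • (x : E3)))
      (fderiv ℝ (radialExtension f) x (x : E3)) 1 := by
    have hd' : HasFDerivAt (radialExtension f) (fderiv ℝ (radialExtension f) x)
        ((1 : ℝ) • (x : E3)) := by rwa [one_smul]
    exact hd'.comp_hasDerivAt (1 : ℝ) h1
  have h3 : HasDerivAt (fun t : ℝ => radialExtension f (t • (x : E3))) 0 1 := by
    refine (hasDerivAt_const (1 : ℝ) (radialExtension f x)).congr_of_eventuallyEq ?_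
    filter_upwards [isOpen_Ioi.mem_nhds (mem_Ioi.2 (one_pos : (0 : ℝ) < 1))] with t ht
    exact radialExtension_smul f ht _
  exact h2.unique h3

theorem fderiv_stereoVec (p v : ℝ × ℝ) :
    fderiv ℝ stereoVec p v = !₂[2 * v.1, 2 * v.2, -(2 * p.1 * v.1) - 2 * p.2 * v.2] := by
  have hd := ((contDiff_stereoVec (n := 1)).differentiable one_ne_zero p).hasFDerivAt
  have hi : ∀ i, HasFDerivAt (fun q => stereoVec q i)
      ((EuclideanSpace.proj i : E3 →L[ℝ] ℝ).comp (fderiv ℝ stereoVec p)) p := fun i =>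
    (EuclideanSpace.proj i : E3 →L[ℝ] ℝ).hasFDerivAt.comp p hd
  have h1 : HasFDerivAt (fun q : ℝ × ℝ => q.1) (ContinuousLinearMap.fst ℝ ℝ ℝ) p := hasFDerivAt_fst
  have h2 : HasFDerivAt (fun q : ℝ × ℝ => q.2) (ContinuousLinearMap.snd ℝ ℝ ℝ) p := hasFDerivAt_snd
  have e0 := (hi 0).unique (h1.const_mul 2)
  have e1 := (hi 1).unique (h2.const_mul 2)
  have e2 := (hi 2).unique (((h1.pow 2).const_sub 1).sub (h2.pow 2))
  ext i
  fin_cases i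
  · simpa using congrArg (fun L : ℝ × ℝ →L[ℝ] ℝ => L v) e0
  · simpa using congrArg (fun L : ℝ × ℝ →L[ℝ] ℝ => L v) e1
  · simpa using congrArg (fun L : ℝ × ℝ →L[ℝ] ℝ => L v) e2

/-- Radial constancy allows `stereoVec` to be used without normalising it; homogeneity of degree -1
of the derivative then accounts for the factor `(stereoDen p)⁻¹`. -/
theorem fderiv_comp_stereo {f : S2 → ℝ} (hf : ContMDiff (𝓡 2) 𝓘(ℝ, ℝ) 1 f) (p v : ℝ × ℝ) :
    fderiv ℝ (f ∘ stereo) p v =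
      (stereoDen p)⁻¹ * inner ℝ (surfaceGradient f (stereo p)) (fderiv ℝ stereoVec p v) := by
  have hd := (contDiffAt_radialExtension hf (stereoVec_ne_zero p)).differentiableAt one_ne_zero
  have h1 := hd.hasFDerivAt.comp p
    ((contDiff_stereoVec (n := 1)).differentiable one_ne_zero p).hasFDerivAt
  rw [show f ∘ stereo = radialExtension f ∘ stereoVec from
    funext fun p => (radialExtension_stereoVec f p).symm, h1.fderiv,
    inner_surfaceGradient, coe_stereo,
    fderiv_radialExtension_smul f (inv_pos.2 (stereoDen_pos p)) (stereoVec p)]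
  simp

theorem inner_eq_sum (a b : E3) : inner ℝ a b = a 0 * b 0 + a 1 * b 1 + a 2 * b 2 := by
  simp [PiLp.inner_apply, Fin.sum_univ_three, mul_comm]

theorem inner_surfaceGradient_stereoVec {f : S2 → ℝ} (hf : ContMDiff (𝓡 2) 𝓘(ℝ, ℝ) 1 f)
    (p : ℝ × ℝ) : inner ℝ (surfaceGradient f (stereo p)) (stereoVec p) = 0 := by
  have := inner_surfaceGradient_self hf (stereo p)
  rw [coe_stereo, inner_smul_right] at this
  exact (mul_eq_zero.1 this).resolve_left (inv_ne_zero (stereoDen_pos p).ne')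

/-- The Jacobian of the stereographic parametrisation. -/
def stereoJac (p : ℝ × ℝ) : ℝ := 4 / stereoDen p ^ 2

theorem stereoJac_mul_poissonBracket {f g : S2 → ℝ} (hf : ContMDiff (𝓡 2) 𝓘(ℝ, ℝ) 1 f)
    (hg : ContMDiff (𝓡 2) 𝓘(ℝ, ℝ) 1 g) (p : ℝ × ℝ) :
    stereoJac p * poissonBracket f g (stereo p) = planarBracket (f ∘ stereo) (g ∘ stereo) p := by
  have ha := inner_surfaceGradient_stereoVec hf p
  have hb := inner_surfaceGradient_stereoVec hg p
  simp only [planarBracket, fderiv_comp_stereo hf, fderiv_comp_stereo hg, fderiv_stereoVec,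
    poissonBracket, coe_stereo, stereoJac]
  generalize surfaceGradient f (stereo p) = a at *
  generalize surfaceGradient g (stereo p) = b at *
  have hd := (stereoDen_pos p).ne'
  simp only [inner_eq_sum, stereoVec] at *
  simp [crossProduct] at *
  field_simp
  simp only [stereoDen]
  -- The two sides agree only modulo the tangency of both surface gradients, which is what `ha` and
  -- `hb` express.
  linear_combination (-2) * (2 * p.1 * b 1 - 2 * p.2 * b 0) * ha
    + 2 * (2 * p.1 * a 1 - 2 * p.2 * a 0) * hb

/-- The gradient is orthogonal to `stereoVec p` and to its two partial derivatives, and these span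
the space. -/
theorem surfaceGradient_eq_zero {f : S2 → ℝ} (hf : ContMDiff (𝓡 2) 𝓘(ℝ, ℝ) 1 f) {p : ℝ × ℝ}
    (h : fderiv ℝ (f ∘ stereo) p = 0) : surfaceGradient f (stereo p) = 0 := by
  have h0 := inner_surfaceGradient_stereoVec hf p
  have h1 := fderiv_comp_stereo hf p (1, 0)
  have h2 := fderiv_comp_stereo hf p (0, 1)
  rw [h, fderiv_stereoVec] at h1 h2
  have hd := inv_ne_zero (stereoDen_pos p).ne'
  replace h1 := (mul_eq_zero.1 h1.symm).resolve_left hd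
  replace h2 := (mul_eq_zero.1 h2.symm).resolve_left hd
  generalize surfaceGradient f (stereo p) = a at *
  simp only [inner_eq_sum, stereoVec] at *
  simp at h0 h1 h2
  have hz : a 2 * stereoDen p = 0 := by
    simp only [stereoDen]
    linear_combination h0 - p.1 * h1 - p.2 * h2
  have e2 : a 2 = 0 := (mul_eq_zero.1 hz).resolve_right (stereoDen_pos p).ne'
  rw [e2] at h1 h2
  ext i
  fin_cases i
  · simp; linarith
  · simp; linarith
  · simpa using e2

end StreamlineAveraging

end

noncomputable section

namespace StreamlineAveraging

open Filter Topology Set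
open scoped Pointwise

/-! ### The surface measure in stereographic coordinates -/

theorem measurePreserving_coordinates :
    MeasurePreserving (fun y : Fin 3 → ℝ => (y 2, (y 0, y 1))) volume
      ((volume : Measure ℝ).prod (volume : Measure (ℝ × ℝ))) := by
  have h1 := volume_preserving_piFinSuccAbove (fun _ : Fin 3 => ℝ) 2
  have h2 : MeasurePreserving (Prod.map id (MeasurableEquiv.finTwoArrow (α := ℝ)))
      ((volume : Measure ℝ).prod volume) ((volume : Measure ℝ).prod volume) :=
    (MeasurePreserving.id _).prod (volume_preserving_finTwoArrow ℝ)
  exact h2.comp h1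

/-- The cone over the stereographic parametrisation. -/
def stereoCone (y : Fin 3 → ℝ) : Fin 3 → ℝ :=
  ![y 2 * (2 * y 0), y 2 * (2 * y 1), y 2 * (1 - y 0 ^ 2 - y 1 ^ 2)]

theorem toLp_stereoCone (y : Fin 3 → ℝ) :
    WithLp.toLp 2 (stereoCone y) = y 2 • stereoVec (y 0, y 1) := by
  ext i
  fin_cases i <;> simp [stereoCone, stereoVec]

/-- The Jacobian matrix of `stereoCone`. -/
def stereoConeMatrix (y : Fin 3 → ℝ) : Matrix (Fin 3) (Fin 3) ℝ :=
  !![2 * y 2, 0, 2 * y 0; 0, 2 * y 2, 2 * y 1;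
    -2 * y 2 * y 0, -2 * y 2 * y 1, 1 - y 0 ^ 2 - y 1 ^ 2]

theorem hasFDerivAt_stereoCone (y : Fin 3 → ℝ) :
    HasFDerivAt stereoCone (Matrix.toLin' (stereoConeMatrix y)).toContinuousLinearMap y := by
  have hc : ∀ i, HasFDerivAt (fun y : Fin 3 → ℝ => y i)
      (ContinuousLinearMap.proj (R := ℝ) (φ := fun _ : Fin 3 => ℝ) i) y := fun i => hasFDerivAt_apply i y
  rw [hasFDerivAt_pi']
  intro i
  fin_cases i
  · refine ((hc 2).mul ((hc 0).const_mul 2)).congr_fderiv (ContinuousLinearMap.ext fun v => ?_)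
    simp [stereoConeMatrix, dotProduct, Fin.sum_univ_three]
    ring
  · refine ((hc 2).mul ((hc 1).const_mul 2)).congr_fderiv (ContinuousLinearMap.ext fun v => ?_)
    simp [stereoConeMatrix, dotProduct, Fin.sum_univ_three]
    ring
  · refine ((hc 2).mul ((((hc 0).pow 2).const_sub 1).sub ((hc 1).pow 2))).congr_fderiv
      (ContinuousLinearMap.ext fun v => ?_)
    simp [stereoConeMatrix, dotProduct, Fin.sum_univ_three]
    ring

theorem det_stereoConeMatrix (y : Fin 3 → ℝ) :
    (Matrix.toLin' (stereoConeMatrix y)).toContinuousLinearMap.det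
      = 4 * y 2 ^ 2 * stereoDen (y 0, y 1) := by
  rw [ContinuousLinearMap.det, LinearMap.coe_toContinuousLinearMap, LinearMap.det_toLin',
    Matrix.det_fin_three]
  simp [stereoConeMatrix, stereoDen]
  ring

/-- The radial part of the cone volume; the factor 1/3 cancels the dimension factor in the
definition of `toSphere`. -/
theorem lintegral_radial {d : ℝ} (hd : 0 < d) :
    ∫⁻ t in Ioo 0 d⁻¹, ENNReal.ofReal |4 * t ^ 2 * d| = ENNReal.ofReal (4 / d ^ 2 / 3) := by
  have h1 : ∫ t in (0 : ℝ)..d⁻¹, |4 * t ^ 2 * d| = 4 / d ^ 2 / 3 := by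
    have : ∀ t : ℝ, |4 * t ^ 2 * d| = 4 * d * t ^ 2 := fun t => by
      rw [abs_of_nonneg (by positivity)]; ring
    simp_rw [this, intervalIntegral.integral_const_mul, integral_pow]
    rw [inv_pow]
    norm_num
    field_simp
  have hci : Continuous fun t : ℝ => |4 * t ^ 2 * d| := by fun_prop
  rw [← h1, intervalIntegral.integral_of_le (inv_pos.2 hd).le, integral_Ioc_eq_integral_Ioo,
    ofReal_integral_eq_lintegral_ofReal]
  · exact hci.integrableOn_Icc.mono_set Ioo_subset_Icc_self
  · exact Eventually.of_forall fun t => abs_nonneg _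

theorem stereoCone_image (Z : Set S2) :
    stereoCone '' {y | (y 0, y 1) ∈ stereo ⁻¹' Z ∧ y 2 ∈ Ioo 0 (stereoDen (y 0, y 1))⁻¹} =
      WithLp.toLp 2 ⁻¹' (Ioo (0 : ℝ) 1 • ((↑) '' (Z \ {southPole}) : Set E3)) := by
  ext v
  simp only [mem_image, mem_preimage, Set.mem_smul]
  constructor
  · rintro ⟨y, ⟨hyZ, hy0, hy1⟩, rfl⟩
    have hd := stereoDen_pos (y 0, y 1)
    refine ⟨y 2 * stereoDen (y 0, y 1), ⟨by positivity, ?_⟩, stereo (y 0, y 1),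
      ⟨_, ⟨hyZ, stereo_ne_southPole _⟩, rfl⟩, ?_⟩
    · calc y 2 * stereoDen (y 0, y 1) < (stereoDen (y 0, y 1))⁻¹ * stereoDen (y 0, y 1) := by gcongr
        _ = 1 := inv_mul_cancel₀ hd.ne'
    · rw [toLp_stereoCone, coe_stereo, smul_smul, mul_assoc, mul_inv_cancel₀ hd.ne', mul_one]
  · rintro ⟨t, ⟨ht0, ht1⟩, _, ⟨x, ⟨hxZ, hx⟩, rfl⟩, hv⟩
    have hd := stereoDen_pos (stereoProj x)
    have hx' := stereo_stereoProj hx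
    refine ⟨![(stereoProj x).1, (stereoProj x).2, t * (stereoDen (stereoProj x))⁻¹], ⟨?_, ?_, ?_⟩, ?_⟩
    · simpa [hx'] using hxZ
    · simp only [Matrix.cons_val]; positivity
    · simp only [Matrix.cons_val]
      exact mul_lt_of_lt_one_left (inv_pos.2 hd) ht1
    · apply (WithLp.toLp_injective 2)
      rw [toLp_stereoCone, ← hv, ← hx', coe_stereo, hx']
      simp [smul_smul]

theorem stereoCone_injOn :
    InjOn stereoCone {y | y 2 ∈ Ioo 0 (stereoDen (y 0, y 1))⁻¹} := by
  intro y hy z hz h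
  have hdy := stereoDen_pos (y 0, y 1)
  have hdz := stereoDen_pos (z 0, z 1)
  have h' := congrArg (WithLp.toLp 2) h
  rw [toLp_stereoCone, toLp_stereoCone] at h'
  have hn := congrArg norm h'
  rw [norm_smul, norm_smul, norm_stereoVec, norm_stereoVec, Real.norm_of_nonneg hy.1.le,
    Real.norm_of_nonneg hz.1.le] at hn
  have hs : stereo (y 0, y 1) = stereo (z 0, z 1) := by
    apply Subtype.ext
    have hpos : 0 < y 2 * stereoDen (y 0, y 1) := mul_pos hy.1 hdy
    have e1 : (stereo (y 0, y 1) : E3) =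
        (y 2 * stereoDen (y 0, y 1))⁻¹ • y 2 • stereoVec (y 0, y 1) := by
      rw [coe_stereo, smul_smul]
      congr 1
      have := hy.1.ne'
      field_simp
    have e2 : (stereo (z 0, z 1) : E3) =
        (z 2 * stereoDen (z 0, z 1))⁻¹ • z 2 • stereoVec (z 0, z 1) := by
      rw [coe_stereo, smul_smul]
      congr 1
      have := hz.1.ne'
      field_simp
    rw [e1, e2, h', hn]
  have hp := stereo_injective hs
  rw [hp] at hn
  have h2 := mul_right_cancel₀ hdz.ne' hn
  have h0 : y 0 = z 0 := congrArg Prod.fst hp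
  have h1 : y 1 = z 1 := congrArg Prod.snd hp
  ext i
  fin_cases i
  · exact h0
  · exact h1
  · exact h2

theorem volume_cone_southPole : volume (Ioo (0 : ℝ) 1 • ({(southPole : E3)} : Set E3)) = 0 := by
  refine measure_mono_null ?_ (Measure.addHaar_submodule volume (Submodule.span ℝ {(southPole : E3)}) ?_)
  · rintro _ ⟨t, -, _, rfl, rfl⟩
    exact Submodule.smul_mem _ _ (Submodule.mem_span_singleton_self _)
  · intro h
    have h1 := finrank_span_singleton (K := ℝ) (coe_ne_zero southPole)
    rw [h, finrank_top] at h1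
    simp at h1

/-- `toSphere` is three times the volume of the cone over a set. Off the null ray through the south
pole this cone is parametrised injectively by `stereoCone`, so a change of variables and radial
integration give the density. -/
theorem area_eq_map : area =
    Measure.map stereo ((volume : Measure (ℝ × ℝ)).withDensity fun p => ENNReal.ofReal (stereoJac p)) := by
  have hcd : Continuous stereoDen := by unfold stereoDen; fun_prop
  ext Z hZ
  have hZ' : MeasurableSet (stereo ⁻¹' Z) := measurableEmbedding_stereo.measurable hZ
  rw [measurableEmbedding_stereo.map_apply, withDensity_apply _ hZ', area,
    Measure.toSphere_apply' _ hZ]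
  set D' : Set (ℝ × (ℝ × ℝ)) := {q | q.2 ∈ stereo ⁻¹' Z ∧ q.1 ∈ Ioo 0 (stereoDen q.2)⁻¹} with hD'
  have hD'm : MeasurableSet D' := by
    refine (measurable_snd hZ').inter (MeasurableSet.inter ?_ ?_)
    · exact measurableSet_lt measurable_const measurable_fst
    · exact measurableSet_lt measurable_fst (hcd.measurable.comp measurable_snd).inv
  set D : Set (Fin 3 → ℝ) := (fun y : Fin 3 → ℝ => (y 2, (y 0, y 1))) ⁻¹' D' with hD
  have hDm : MeasurableSet D := measurePreserving_coordinates.measurable hD'm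
  have e1 : volume (Ioo (0 : ℝ) 1 • ((↑) '' Z : Set E3)) =
      volume (Ioo (0 : ℝ) 1 • ((↑) '' (Z \ {southPole}) : Set E3)) := by
    apply le_antisymm
    · have : Ioo (0 : ℝ) 1 • ((↑) '' Z : Set E3) ⊆
          Ioo (0 : ℝ) 1 • ((↑) '' (Z \ {southPole}) : Set E3) ∪
            Ioo (0 : ℝ) 1 • ({(southPole : E3)} : Set E3) := by
        rw [← Set.smul_union]
        refine Set.smul_subset_smul_left ?_
        rintro _ ⟨x, hx, rfl⟩
        by_cases h : x = southPole
        · right; simp [h]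
        · left; exact ⟨x, ⟨hx, h⟩, rfl⟩
      refine (measure_mono this).trans ((measure_union_le _ _).trans ?_)
      rw [volume_cone_southPole, add_zero]
    · exact measure_mono (Set.smul_subset_smul_left (image_mono sdiff_subset))
  have e2 : volume (Ioo (0 : ℝ) 1 • ((↑) '' (Z \ {southPole}) : Set E3)) = volume (stereoCone '' D) := by
    rw [hD, hD']
    have := stereoCone_image Z
    simp only [preimage_ofPred_eq]
    rw [this]
    exact ((PiLp.volume_preserving_toLp (Fin 3)).measure_preimage_emb
      (MeasurableEquiv.toLp 2 (Fin 3 → ℝ)).measurableEmbedding _).symm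
  have e3 : volume (stereoCone '' D) = ∫⁻ y in D, ENNReal.ofReal |4 * y 2 ^ 2 * stereoDen (y 0, y 1)| := by
    rw [← lintegral_abs_det_fderiv_eq_addHaar_image volume hDm
      (fun y _ => (hasFDerivAt_stereoCone y).hasFDerivWithinAt)
      (stereoCone_injOn.mono fun y hy => hy.2)]
    simp_rw [det_stereoConeMatrix]
  have hfm : Measurable fun q : ℝ × (ℝ × ℝ) => ENNReal.ofReal |4 * q.1 ^ 2 * stereoDen q.2| := by
    have : Continuous fun q : ℝ × (ℝ × ℝ) => |4 * q.1 ^ 2 * stereoDen q.2| := by fun_prop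
    exact this.measurable.ennreal_ofReal
  have e4 : ∫⁻ y in D, ENNReal.ofReal |4 * y 2 ^ 2 * stereoDen (y 0, y 1)| =
      ∫⁻ p in stereo ⁻¹' Z, ENNReal.ofReal (stereoJac p / 3) := by
    rw [hD, measurePreserving_coordinates.setLIntegral_comp_preimage hD'm hfm,
      ← lintegral_indicator hD'm, lintegral_prod_symm _ (hfm.indicator hD'm).aemeasurable,
      ← lintegral_indicator hZ']
    congr 1
    ext p
    by_cases hp : p ∈ stereo ⁻¹' Z
    · rw [indicator_of_mem hp, stereoJac, ← lintegral_radial (stereoDen_pos p),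
        ← lintegral_indicator measurableSet_Ioo]
      congr 1
      ext t
      simp only [indicator, hD', mem_ofPred_eq, hp, true_and]
    · rw [indicator_of_notMem hp]
      have : ∀ t, (t, p) ∉ D' := fun t ht => hp ht.1
      simp [indicator, this]
  rw [e1, e2, e3, e4, ← lintegral_const_mul]
  · congr 1
    ext p
    rw [show (Module.finrank ℝ E3) = 3 by simp, show ((3 : ℕ) : ENNReal) = ENNReal.ofReal 3 by simp,
      ← ENNReal.ofReal_mul (by norm_num)]
    congr 1
    ring
  · have : Continuous fun p => stereoJac p / 3 := by
      unfold stereoJac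
      exact (continuous_const.div (hcd.pow 2) fun p => pow_ne_zero 2 (stereoDen_pos p).ne').div_const _
    exact this.measurable.ennreal_ofReal

theorem stereoJac_pos (p : ℝ × ℝ) : 0 < stereoJac p := by
  have := stereoDen_pos p
  unfold stereoJac
  positivity

theorem measurable_stereoJac : Measurable stereoJac := by
  unfold stereoJac stereoDen
  fun_prop

theorem area_eq_zero_iff {Z : Set S2} : area Z = 0 ↔ volume (stereo ⁻¹' Z) = 0 := by
  rw [area_eq_map, measurableEmbedding_stereo.map_apply,
    withDensity_apply_eq_zero' measurable_stereoJac.ennreal_ofReal.aemeasurable]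
  have : {p | ENNReal.ofReal (stereoJac p) ≠ 0} = univ := by
    ext p
    simp [stereoJac_pos p]
  rw [this, univ_inter]

theorem ae_area_iff {P : S2 → Prop} : (∀ᵐ x ∂area, P x) ↔ ∀ᵐ p, P (stereo p) := by
  rw [ae_iff, ae_iff, area_eq_zero_iff]
  rfl

theorem integral_area (f : S2 → ℝ) : ∫ x, f x ∂area = ∫ p, stereoJac p * f (stereo p) := by
  rw [area_eq_map, measurableEmbedding_stereo.integral_map,
    integral_withDensity_eq_integral_toReal_smul measurable_stereoJac.ennreal_ofReal (by simp)]
  simp [ENNReal.toReal_ofReal, (stereoJac_pos _).le]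

theorem integral_mul_poissonBracket {f g : S2 → ℝ} (hf : ContMDiff (𝓡 2) 𝓘(ℝ, ℝ) 1 f)
    (hg : ContMDiff (𝓡 2) 𝓘(ℝ, ℝ) 1 g) (w : S2 → ℝ) :
    ∫ x, w x * poissonBracket f g x ∂area =
      ∫ p, w (stereo p) * planarBracket (f ∘ stereo) (g ∘ stereo) p := by
  rw [integral_area]
  congr 1
  ext p
  rw [← stereoJac_mul_poissonBracket hf hg]
  ring

end StreamlineAveraging

end

noncomputable section

namespace StreamlineAveraging

open Filter Topology Set

/-! ### Components of streamlines -/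

theorem mem_streamlineComponent_self (ψ : S2 → ℝ) (x : S2) : x ∈ streamlineComponent ψ x :=
  mem_connectedComponentIn rfl

theorem eq_of_mem_streamlineComponent {ψ : S2 → ℝ} {x y : S2} (h : y ∈ streamlineComponent ψ x) :
    ψ y = ψ x := connectedComponentIn_subset (ψ ⁻¹' {ψ x}) x h

theorem streamlineComponent_eq {ψ : S2 → ℝ} {x y : S2} (h : y ∈ streamlineComponent ψ x) :
    streamlineComponent ψ y = streamlineComponent ψ x := by
  unfold streamlineComponent at *
  rw [connectedComponentIn_eq h, eq_of_mem_streamlineComponent h]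

theorem isPreconnected_streamlineComponent (ψ : S2 → ℝ) (x : S2) :
    IsPreconnected (streamlineComponent ψ x) := isPreconnected_connectedComponentIn

theorem ne_southPole_of_mem_streamlineComponent {ψ : S2 → ℝ} {x y : S2} (hx : ψ x ≠ ψ southPole)
    (h : y ∈ streamlineComponent ψ x) : y ≠ southPole := by
  rintro rfl
  exact hx (eq_of_mem_streamlineComponent h).symm

/-! ### Test functions -/

open Classical in
/-- The function on the sphere which is `φ` in the stereographic chart and vanishes at the south
pole. -/
def pushTest (φ : ℝ × ℝ → ℝ) (x : S2) : ℝ := if x = southPole then 0 else φ (stereoProj x)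

theorem pushTest_comp_stereo (φ : ℝ × ℝ → ℝ) : pushTest φ ∘ stereo = φ := by
  ext p
  simp [pushTest, stereo_ne_southPole, stereoProj_stereo]

/-- The compact image of the support misses the south pole, so the function vanishes near it;
elsewhere `stereoProj` is a rational expression in the ambient coordinates. -/
theorem contMDiff_pushTest {φ : ℝ × ℝ → ℝ} (hφ : ContDiff ℝ ∞ φ) (hc : HasCompactSupport φ) :
    ContMDiff (𝓡 2) 𝓘(ℝ, ℝ) ∞ (pushTest φ) := by
  have : Fact (Module.finrank ℝ E3 = 2 + 1) := ⟨by simp⟩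
  intro x
  by_cases hx : x = southPole
  · have hK : IsClosed (stereo '' tsupport φ) := (hc.isCompact.image continuous_stereo).isClosed
    refine contMDiffAt_const (c := (0 : ℝ)).congr_of_eventuallyEq ?_
    have hxK : x ∈ (stereo '' tsupport φ)ᶜ := by
      rintro ⟨p, -, hp⟩
      exact stereo_ne_southPole p (hp.trans hx)
    filter_upwards [hK.isOpen_compl.mem_nhds hxK] with y hy
    unfold pushTest
    split_ifs with h
    · rfl
    · by_contra h0
      exact hy ⟨stereoProj y, subset_tsupport _ h0, stereo_stereoProj h⟩
  · have h0 := one_add_ne_zero_of_ne_southPole hx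
    set Φ : E3 → ℝ := fun y => φ (y 0 / (1 + y 2), y 1 / (1 + y 2)) with hΦ
    have hc : ∀ i, ContDiff ℝ ∞ fun y : E3 => y i := fun i =>
      (EuclideanSpace.proj i : E3 →L[ℝ] ℝ).contDiff
    have h1 : ContDiffAt ℝ ∞ Φ (x : E3) :=
      hφ.contDiffAt.comp (x : E3)
        ((((hc 0).contDiffAt).div (contDiffAt_const.add (hc 2).contDiffAt) h0).prodMk
          (((hc 1).contDiffAt).div (contDiffAt_const.add (hc 2).contDiffAt) h0))
    have h2 : ContMDiffAt (𝓡 2) 𝓘(ℝ, ℝ) ∞ (Φ ∘ ((↑) : S2 → E3)) x :=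
      ContMDiffAt.comp x h1.contMDiffAt contMDiff_coe_sphere.contMDiffAt
    refine h2.congr_of_eventuallyEq ?_
    filter_upwards [isOpen_compl_singleton.mem_nhds hx] with y hy
    simp [pushTest, show y ≠ southPole from hy, hΦ, stereoProj]

/-! ### Functions in the stabiliser are constant on components -/

/-- Such zeros are isolated among all zeros. For a difference of two local factors, this says that
equal values force equal derivatives off a countable set. -/
theorem countable_zeros_of_deriv_ne_zero (f : ℝ → ℝ) :
    {c | f c = 0 ∧ DifferentiableAt ℝ f c ∧ deriv f c ≠ 0}.Countable := by
  refine (countable_setOfPred_isolated_right_within (s := {c | f c = 0})).mono ?_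
  rintro c ⟨h0, hd, hne⟩
  refine ⟨h0, ?_⟩
  have h1 : ∀ᶠ z in 𝓝[≠] c, f z ≠ 0 := hd.hasDerivAt.eventually_ne hne
  have h2 : 𝓝[{c | f c = 0} ∩ Ioi c] c ≤ 𝓝[≠] c :=
    nhdsWithin_mono _ fun z hz => (mem_Ioi.1 hz.2).ne'
  rw [← empty_mem_iff_bot]
  have h3 := h2 h1
  filter_upwards [h3, self_mem_nhdsWithin] with z hz hz'
  exact hz hz'.1

theorem subsingleton_of_volume_eq_zero {s : Set ℝ} (hs : IsPreconnected s) (h0 : volume s = 0) :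
    s.Subsingleton := by
  have key : ∀ a ∈ s, ∀ b ∈ s, ¬ a < b := by
    intro a ha b hb hab
    have := measure_mono_null (hs.Icc_subset ha hb) h0
    rw [Real.volume_Icc, ENNReal.ofReal_eq_zero] at this
    linarith
  intro a ha b hb
  exact le_antisymm (not_lt.1 (key b hb a ha)) (not_lt.1 (key a ha b hb))

theorem volume_critical_comp_stereo {ψ : S2 → ℝ} (hψ : IsGeneric ψ) :
    volume {p | fderiv ℝ (ψ ∘ stereo) p = 0} = 0 := by
  refine measure_mono_null (fun p hp => ?_) (area_eq_zero_iff.1 hψ.area_criticalSet)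
  exact surfaceGradient_eq_zero hψ.contMDiff hp

theorem exists_isConstantOn_of_stab {ψ : S2 → ℝ} (hψ : IsGeneric ψ) {w : S2 → ℝ} (hw : Measurable w)
    {M : ℝ} (hM : ∀ x, |w x| ≤ M)
    (h : ∀ φ : S2 → ℝ, ContMDiff (𝓡 2) 𝓘(ℝ, ℝ) ∞ φ → weakPoissonBracket ψ w φ = 0) :
    ∃ g, IsConstantOnStreamlineComponents ψ g ∧ w =ᵐ[area] g := by
  classical
  have hψ1 := contDiff_comp_stereo hψ.contMDiff
  have hcrit := volume_critical_comp_stereo hψ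
  obtain ⟨H, hHc, hHnull, ι, hι, B, G, hHG, hwG, hdiff⟩ := exists_potential_factorization hψ1 hcrit
    (hw.comp continuous_stereo.measurable) (M := M) (fun p => hM _) (fun φ hφ hφc => by
      have hs := contMDiff_pushTest hφ hφc
      have := h _ hs
      rw [weakPoissonBracket, neg_eq_zero,
        integral_mul_poissonBracket hψ.contMDiff (hs.of_le (by simp)),
        pushTest_comp_stereo] at this
      exact this)
  set bad : ι → ι → Set ℝ := fun i j => {c | (G i - G j) c = 0 ∧
    DifferentiableAt ℝ (G i - G j) c ∧ deriv (G i - G j) c ≠ 0} with hbad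
  -- Discarding the level of the south pole leaves only components that lie inside the chart.
  have hgood : ∀ᵐ c : ℝ, volume (H '' ((ψ ∘ stereo) ⁻¹' {c})) = 0 ∧
      (∀ i, c ∈ (ψ ∘ stereo) '' B i → DifferentiableAt ℝ (G i) c) ∧
      (∀ i j, c ∉ bad i j) ∧ c ≠ ψ southPole := by
    have h1 : ∀ᵐ c : ℝ, ∀ i j, c ∉ bad i j := by
      rw [ae_all_iff]; intro i
      rw [ae_all_iff]; intro j
      exact measure_eq_zero_iff_ae_notMem.1 ((countable_zeros_of_deriv_ne_zero _).measure_zero volume)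
    have h2 : ∀ᵐ c : ℝ, c ≠ ψ southPole :=
      measure_eq_zero_iff_ae_notMem.1 (measure_singleton (ψ southPole))
    filter_upwards [hHnull, hdiff, h1, h2] with c a b d e using ⟨a, b, d, e⟩
  set N : Set ℝ := {c | ¬ (volume (H '' ((ψ ∘ stereo) ⁻¹' {c})) = 0 ∧
      (∀ i, c ∈ (ψ ∘ stereo) '' B i → DifferentiableAt ℝ (G i) c) ∧
      (∀ i j, c ∉ bad i j) ∧ c ≠ ψ southPole)} with hN
  have hN0 : volume N = 0 := hgood
  have key : ∀ x, ψ x ∉ N → ∀ i j p q, p ∈ B i → q ∈ B j → stereo p ∈ streamlineComponent ψ x →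
      stereo q ∈ streamlineComponent ψ x → deriv (G i) (ψ x) = deriv (G j) (ψ x) := by
    intro x hx i j p q hp hq hpx hqx
    obtain ⟨h1, h2, h3, h4⟩ := not_not.1 hx
    have himg : IsPreconnected ((H ∘ stereoProj) '' streamlineComponent ψ x) :=
      (isPreconnected_streamlineComponent ψ x).image _
        (hHc.comp_continuousOn (continuousOn_stereoProj.mono fun y hy =>
          ne_southPole_of_mem_streamlineComponent h4 hy))
    -- A connected set of reals of measure zero is at most a point, so `H` is constant on the
    -- component, critical points included.
    have hsub : ((H ∘ stereoProj) '' streamlineComponent ψ x).Subsingleton := by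
      refine subsingleton_of_volume_eq_zero himg (measure_mono_null ?_ h1)
      rintro _ ⟨y, hy, rfl⟩
      refine ⟨stereoProj y, ?_, rfl⟩
      simp [stereo_stereoProj (ne_southPole_of_mem_streamlineComponent h4 hy),
        eq_of_mem_streamlineComponent hy]
    have hpq := hsub ⟨_, hpx, rfl⟩ ⟨_, hqx, rfl⟩
    have ep := eq_of_mem_streamlineComponent hpx
    have eq := eq_of_mem_streamlineComponent hqx
    simp only [Function.comp, stereoProj_stereo, hHG i p hp, hHG j q hq, ep, eq] at hpq
    have di := h2 i ⟨p, hp, ep⟩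
    have dj := h2 j ⟨q, hq, eq⟩
    by_contra hne
    refine h3 i j ⟨?_, di.sub dj, ?_⟩
    · simp [hpq]
    · rw [deriv_sub di dj]
      exact sub_ne_zero.2 hne
  -- The chosen index depends only on the component, so `g` is constant on components at every
  -- level; the default 0 serves components that meet no box.
  set g : S2 → ℝ := fun x =>
    if hx : ∃ i, ∃ p ∈ B i, stereo p ∈ streamlineComponent ψ x then deriv (G hx.choose) (ψ x) else 0
    with hg
  refine ⟨g, fun x y hy => ?_, ?_⟩
  · simp only [hg, streamlineComponent_eq hy, eq_of_mem_streamlineComponent hy]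
  · refine ae_area_iff.2 ?_
    have hN' : ∀ᵐ p, (ψ ∘ stereo) p ∉ N :=
      measure_eq_zero_iff_ae_notMem.1 (volume_preimage_eq_zero hψ1 hcrit hN0)
    filter_upwards [hN', hwG] with p hp ⟨i, hi, hd⟩
    have hx : ∃ i, ∃ q ∈ B i, stereo q ∈ streamlineComponent ψ (stereo p) :=
      ⟨i, p, hi, mem_streamlineComponent_self _ _⟩
    simp only [hg, dif_pos hx]
    obtain ⟨q, hq, hqx⟩ := hx.choose_spec
    rw [← key _ hp i _ p q hi hq (mem_streamlineComponent_self _ _) hqx]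
    exact hd.deriv.symm

end StreamlineAveraging

end

noncomputable section

namespace StreamlineAveraging

open Filter Topology Set

instance : IsFiniteMeasure area := by unfold area; infer_instance

/-! ### Cutoff functions constant along streamlines -/

/-- A `C¹` function with values in `[0, 1]`, vanishing near the south pole, constant on the
components of the streamlines of `ψ`, and with gradient parallel to that of `ψ`. -/
structure IsStreamCutoff (ψ F : S2 → ℝ) : Prop where
  const : IsConstantOnStreamlineComponents ψ F
  mem_Icc : ∀ x, F x ∈ Icc (0 : ℝ) 1
  contDiff : ContDiff ℝ 1 (F ∘ stereo)
  hasCompactSupport : HasCompactSupport (F ∘ stereo)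
  parallel : ∀ p, ∃ l : ℝ, fderiv ℝ (F ∘ stereo) p = l • fderiv ℝ (ψ ∘ stereo) p

theorem IsStreamCutoff.zero (ψ : S2 → ℝ) : IsStreamCutoff ψ fun _ => 0 where
  const _ _ _ := rfl
  mem_Icc _ := by simp
  contDiff := contDiff_const
  hasCompactSupport := HasCompactSupport.zero
  parallel p := ⟨0, by rw [zero_smul]; exact congrFun (fderiv_const (0 : ℝ)) p⟩

theorem IsStreamCutoff.mul {ψ F F' : S2 → ℝ} (h : IsStreamCutoff ψ F) (h' : IsStreamCutoff ψ F') :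
    IsStreamCutoff ψ fun x => F x * F' x where
  const x y hy := by simp only [h.const x y hy, h'.const x y hy]
  mem_Icc x := ⟨mul_nonneg (h.mem_Icc x).1 (h'.mem_Icc x).1,
    mul_le_one₀ (h.mem_Icc x).2 (h'.mem_Icc x).1 (h'.mem_Icc x).2⟩
  contDiff := h.contDiff.mul h'.contDiff
  hasCompactSupport := h.hasCompactSupport.mul_right (f' := F' ∘ stereo)
  parallel p := by
    obtain ⟨l, hl⟩ := h.parallel p
    obtain ⟨l', hl'⟩ := h'.parallel p
    have := ((h.contDiff.differentiable one_ne_zero p).hasFDerivAt.mul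
      (h'.contDiff.differentiable one_ne_zero p).hasFDerivAt).fderiv
    refine ⟨F (stereo p) * l' + F' (stereo p) * l, this.trans ?_⟩
    rw [hl, hl', smul_smul, smul_smul, ← add_smul]
    rfl

/-- The function is `1 - (1 - F) * (1 - F')`: it is 1 where either factor is 1 and 0 where both
vanish. -/
theorem IsStreamCutoff.union {ψ F F' : S2 → ℝ} (h : IsStreamCutoff ψ F) (h' : IsStreamCutoff ψ F') :
    IsStreamCutoff ψ fun x => F x + F' x - F x * F' x where
  const x y hy := by simp only [h.const x y hy, h'.const x y hy]
  mem_Icc x := by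
    have h1 := h.mem_Icc x
    have h2 := h'.mem_Icc x
    constructor
    · nlinarith [mul_nonneg h2.1 (sub_nonneg.2 h1.2), h1.1]
    · nlinarith [mul_nonneg (sub_nonneg.2 h1.2) (sub_nonneg.2 h2.2)]
  contDiff := (h.contDiff.add h'.contDiff).sub (h.contDiff.mul h'.contDiff)
  hasCompactSupport := (h.hasCompactSupport.add h'.hasCompactSupport).sub
    (h.hasCompactSupport.mul_right (f' := F' ∘ stereo))
  parallel p := by
    obtain ⟨l, hl⟩ := h.parallel p
    obtain ⟨l', hl'⟩ := h'.parallel p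
    have d := (h.contDiff.differentiable one_ne_zero p).hasFDerivAt
    have d' := (h'.contDiff.differentiable one_ne_zero p).hasFDerivAt
    have := ((d.add d').sub (d.mul d')).fderiv
    refine ⟨l + l' - (F (stereo p) * l' + F' (stereo p) * l), this.trans ?_⟩
    rw [hl, hl', smul_smul, smul_smul, ← add_smul, ← add_smul, ← sub_smul]
    rfl

/-- Parallel gradients kill the bracket of `ψ` with `F`, so `F` can be moved inside: the integrand
is the bracket of `ψ` with the compactly supported `F φ`. -/
theorem IsStreamCutoff.integral_eq_zero {ψ F φ : S2 → ℝ} (h : IsStreamCutoff ψ F)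
    (hψ : ContMDiff (𝓡 2) 𝓘(ℝ, ℝ) 1 ψ) (hφ : ContMDiff (𝓡 2) 𝓘(ℝ, ℝ) 1 φ) :
    ∫ x, F x * poissonBracket ψ φ x ∂area = 0 := by
  have hφ' := contDiff_comp_stereo hφ
  rw [integral_mul_poissonBracket hψ hφ,
    ← integral_planarBracket_eq_zero_of_contDiff_one (contDiff_comp_stereo hψ)
      (h.contDiff.mul hφ') h.hasCompactSupport.mul_right]
  congr 1
  ext p
  obtain ⟨l, hl⟩ := h.parallel p
  have := ((h.contDiff.differentiable one_ne_zero p).hasFDerivAt.mul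
      (hφ'.differentiable one_ne_zero p).hasFDerivAt).fderiv
  have e : fderiv ℝ (fun x => (F ∘ stereo) x * (φ ∘ stereo) x) p = _ := this
  simp only [planarBracket, e, hl]
  simp
  ring

/-- A smooth function of `ψ` localised to an open set whose frontier avoids a level set. -/
theorem exists_isStreamCutoff_of_frontier {ψ : S2 → ℝ} (hψ : ContMDiff (𝓡 2) 𝓘(ℝ, ℝ) 1 ψ)
    {V : Set S2} (hV : IsOpen V) {c : ℝ} (hc : c ≠ ψ southPole) (hfr : ∀ x ∈ frontier V, ψ x ≠ c)
    {e : ℝ} (he : 0 < e) :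
    ∃ r, 0 < r ∧ r ≤ e ∧ ∃ F, IsStreamCutoff ψ F ∧ (∀ x ∈ V, |ψ x - c| ≤ r / 2 → F x = 1) ∧
      (∀ x, r ≤ |ψ x - c| → F x = 0) ∧ ∀ x, x ∉ V → F x = 0 := by
  classical
  have hψc : Continuous ψ := hψ.continuous
  obtain ⟨δ, hδ, hδfr⟩ := (isClosed_frontier (s := V)).isCompact.exists_forall_le'
    (f := fun x => |ψ x - c|) (by fun_prop) (a := 0) fun x hx => abs_pos.2 (sub_ne_zero.2 (hfr x hx))
  have hpole : 0 < |ψ southPole - c| := abs_pos.2 (sub_ne_zero.2 hc.symm)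
  -- Below `δ`, so that the bump of `ψ` vanishes near the frontier of `V`; below the gap to the
  -- polar value, so that `F` vanishes near the pole; at most `e`, as required.
  set r := min e (min (δ / 2) (|ψ southPole - c| / 2)) with hr
  have hr0 : 0 < r := lt_min he (lt_min (by positivity) (by positivity))
  have hrδ : r < δ := by
    have : r ≤ δ / 2 := (min_le_right _ _).trans (min_le_left _ _)
    linarith
  have hrp : r < |ψ southPole - c| := by
    have : r ≤ |ψ southPole - c| / 2 := (min_le_right _ _).trans (min_le_right _ _)
    linarith
  let χ : ContDiffBump c := ⟨r / 2, r, by positivity, by linarith⟩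
  have hχ0 : ∀ t, r ≤ |t - c| → χ t = 0 := fun t ht => χ.zero_of_le_dist (by rwa [Real.dist_eq])
  have hχ1 : ∀ t, |t - c| ≤ r / 2 → χ t = 1 := fun t ht =>
    χ.one_of_mem_closedBall (by rwa [mem_closedBall, Real.dist_eq])
  set F : S2 → ℝ := V.indicator fun x => χ (ψ x) with hF
  have hF0 : ∀ x, r ≤ |ψ x - c| → F x = 0 := fun x hx => by
    simp [hF, indicator, hχ0 _ hx]
  have hfrV : frontier V = closure V \ V := by rw [frontier, hV.interior_eq]
  have hψ1 := contDiff_comp_stereo hψ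
  have hχψ : ContDiff ℝ 1 fun p => χ (ψ (stereo p)) := χ.contDiff.comp hψ1
  -- The jump of the indicator is invisible, since the bump already vanishes near the frontier.
  have hloc : ∀ p, (F ∘ stereo =ᶠ[𝓝 p] fun p => χ (ψ (stereo p))) ∨ F ∘ stereo =ᶠ[𝓝 p] fun _ => 0 := by
    intro p
    by_cases h1 : stereo p ∈ V
    · left
      filter_upwards [(hV.preimage continuous_stereo).mem_nhds h1] with q hq
      exact indicator_of_mem (s := V) hq fun x => χ (ψ x)
    · right
      by_cases h2 : stereo p ∈ closure V
      · have h3 : r < |ψ (stereo p) - c| := hrδ.trans_le (hδfr _ (hfrV ▸ ⟨h2, h1⟩))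
        have hcont : Continuous fun q => |ψ (stereo q) - c| :=
          ((hψc.comp continuous_stereo).sub continuous_const).abs
        filter_upwards [(isOpen_Ioi.preimage hcont).mem_nhds h3] with q hq
        exact hF0 _ (le_of_lt hq)
      · filter_upwards [((isClosed_closure (s := V)).isOpen_compl.preimage
          continuous_stereo).mem_nhds h2] with q hq
        exact indicator_of_notMem (s := V) (fun h => hq (subset_closure h)) fun x => χ (ψ x)
  refine ⟨r, hr0, min_le_left _ _, F, ⟨?_, ?_, ?_, ?_, ?_⟩, ?_, hF0, ?_⟩
  · intro x y hy
    have hyx := eq_of_mem_streamlineComponent hy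
    by_cases hx : r ≤ |ψ x - c|
    · rw [hF0 x hx, hF0 y (hyx ▸ hx)]
    · have hsub : streamlineComponent ψ x ⊆ V ∪ (closure V)ᶜ := by
        intro z hz
        by_contra hzV
        simp only [mem_union, not_or, mem_compl_iff, not_not] at hzV
        have := hδfr z (hfrV ▸ ⟨hzV.2, hzV.1⟩)
        rw [eq_of_mem_streamlineComponent hz] at this
        exact hx (hrδ.le.trans this)
      have hdis : Disjoint V (closure V)ᶜ := disjoint_compl_right.mono_left subset_closure
      have hpre := isPreconnected_streamlineComponent ψ x
      have hx0 := mem_streamlineComponent_self ψ x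
      have hmem : y ∈ V ↔ x ∈ V := by
        constructor
        · intro h
          exact hpre.subset_left_of_subset_union hV isClosed_closure.isOpen_compl hdis hsub
            ⟨y, hy, h⟩ hx0
        · intro h
          exact hpre.subset_left_of_subset_union hV isClosed_closure.isOpen_compl hdis hsub
            ⟨x, hx0, h⟩ hy
      simp only [hF, indicator, hmem, hyx]
  · intro x
    simp only [hF, indicator]
    split_ifs
    · exact ⟨χ.nonneg, χ.le_one⟩
    · simp
  · refine contDiff_iff_contDiffAt.2 fun p => ?_
    rcases hloc p with h | h
    · exact hχψ.contDiffAt.congr_of_eventuallyEq h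
    · exact contDiffAt_const.congr_of_eventuallyEq h
  · have hK : IsCompact {x | |ψ x - c| ≤ r} :=
      (isClosed_le (by fun_prop) continuous_const).isCompact
    have hKp : {x | |ψ x - c| ≤ r} ⊆ {southPole}ᶜ := by
      rintro x hx rfl
      exact absurd hrp (not_lt.2 hx)
    refine HasCompactSupport.of_support_subset_isCompact
      (hK.image_of_continuousOn (continuousOn_stereoProj.mono hKp)) fun p hp => ?_
    refine ⟨stereo p, ?_, stereoProj_stereo p⟩
    by_contra h
    exact hp (hF0 _ (le_of_lt (not_le.1 h)))
  · intro p
    rcases hloc p with h | h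
    · rw [h.fderiv_eq]
      refine ⟨deriv χ (ψ (stereo p)), ?_⟩
      have h1 : HasDerivAt χ (deriv χ (ψ (stereo p))) (ψ (stereo p)) :=
        (χ.contDiff (n := 1)).differentiable one_ne_zero _ |>.hasDerivAt
      exact (h1.comp_hasFDerivAt p (hψ1.differentiable one_ne_zero p).hasFDerivAt).fderiv
    · refine ⟨0, ?_⟩
      rw [h.fderiv_eq, zero_smul]
      exact congrFun (fderiv_const (0 : ℝ)) p
  · intro x hx hx'
    simp only [hF, indicator_of_mem hx, hχ1 _ hx']
  · intro x hx
    exact indicator_of_notMem hx _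

/-- A component of a level set is separated from each other point of the level set by an open set
whose frontier avoids the level set. -/
theorem exists_isOpen_separating {ψ : S2 → ℝ} (hψ : Continuous ψ) {x y : S2} (hxy : ψ x = ψ y)
    (hx : x ∉ streamlineComponent ψ y) :
    ∃ V, IsOpen V ∧ y ∈ V ∧ x ∉ closure V ∧ ∀ z ∈ frontier V, ψ z ≠ ψ y := by
  set E : Set S2 := ψ ⁻¹' {ψ y} with hE
  have hEc : IsClosed E := isClosed_singleton.preimage hψ
  have : CompactSpace E := isCompact_iff_compactSpace.1 hEc.isCompact
  have hyE : y ∈ E := rfl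
  have hxE : x ∈ E := hxy
  rw [streamlineComponent, connectedComponentIn_eq_image hyE] at hx
  have hx1 : (⟨x, hxE⟩ : E) ∉ connectedComponent (⟨y, hyE⟩ : E) := fun h => hx ⟨_, h, rfl⟩
  -- In the compact level set, components are intersections of clopen sets, so some clopen `A`
  -- contains `y` but not `x`.
  rw [connectedComponent_eq_iInter_isClopen, mem_iInter, not_forall] at hx1
  obtain ⟨⟨A, hA, hyA⟩, hxA⟩ := hx1
  have hA1 : IsClosed ((↑) '' A : Set S2) := hEc.isClosedEmbedding_subtypeVal.isClosedMap _ hA.1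
  have hA2 : IsClosed ((↑) '' Aᶜ : Set S2) :=
    hEc.isClosedEmbedding_subtypeVal.isClosedMap _ hA.compl.1
  have hsub : ((↑) '' A : Set S2) ⊆ ((↑) '' Aᶜ : Set S2)ᶜ := by
    rintro _ ⟨a, ha, rfl⟩ ⟨b, hb, hab⟩
    exact hb (Subtype.ext hab ▸ ha)
  -- `V` contains `A` and its closure avoids the rest of the level set, so its frontier avoids the
  -- level set altogether.
  obtain ⟨V, hVo, hAV, hVA⟩ := normal_exists_closure_subset hA1 hA2.isOpen_compl hsub
  refine ⟨V, hVo, hAV ⟨_, hyA, rfl⟩, fun h => hVA h ⟨_, hxA, rfl⟩, fun z hz hzy => ?_⟩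
  rw [frontier, hVo.interior_eq] at hz
  by_cases hzA : (⟨z, hzy⟩ : E) ∈ A
  · exact hz.2 (hAV ⟨_, hzA, rfl⟩)
  · exact hVA hz.1 ⟨_, hzA, rfl⟩

/-- Points on the same level are separated by an open `V` as above. For different levels a bump of
`ψ` with `V = univ` suffices. -/
theorem exists_isStreamCutoff_separating {ψ : S2 → ℝ} (hψ : ContMDiff (𝓡 2) 𝓘(ℝ, ℝ) 1 ψ) {x y : S2}
    (hy : ψ y ≠ ψ southPole) (hx : x ∉ streamlineComponent ψ y) :
    ∃ F, IsStreamCutoff ψ F ∧ (∀ᶠ z in 𝓝 x, F z = 0) ∧ ∀ᶠ z in 𝓝 y, F z = 1 := by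
  have hψc : Continuous ψ := hψ.continuous
  have hnear : ∀ r : ℝ, 0 < r → ∀ᶠ z in 𝓝 y, |ψ z - ψ y| ≤ r / 2 := by
    intro r hr
    have : Continuous fun z => |ψ z - ψ y| := by fun_prop
    filter_upwards [(isOpen_Iio.preimage this).mem_nhds
      (show |ψ y - ψ y| ∈ Iio (r / 2) by simpa using hr)] with z hz using le_of_lt hz
  by_cases hxy : ψ x = ψ y
  · obtain ⟨V, hVo, hyV, hxV, hfr⟩ := exists_isOpen_separating hψc hxy hx
    obtain ⟨r, hr, -, F, hF, h1, -, h3⟩ := exists_isStreamCutoff_of_frontier hψ hVo hy hfr one_pos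
    refine ⟨F, hF, ?_, ?_⟩
    · filter_upwards [isClosed_closure.isOpen_compl.mem_nhds hxV] with z hz
      exact h3 z fun h => hz (subset_closure h)
    · filter_upwards [hVo.mem_nhds hyV, hnear r hr] with z hz hz'
      exact h1 z hz hz'
  · have h0 : 0 < |ψ x - ψ y| := abs_pos.2 (sub_ne_zero.2 hxy)
    obtain ⟨r, hr, hre, F, hF, h1, h2, -⟩ := exists_isStreamCutoff_of_frontier hψ isOpen_univ hy
      (by simp) (e := |ψ x - ψ y| / 2) (by positivity)
    refine ⟨F, hF, ?_, ?_⟩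
    · have hc : Continuous fun z => |ψ z - ψ y| := by fun_prop
      filter_upwards [(isOpen_Ioi.preimage hc).mem_nhds
        (show |ψ x - ψ y| ∈ Ioi r by rw [mem_Ioi]; linarith)] with z hz
      exact h2 z (le_of_lt hz)
    · filter_upwards [hnear r hr] with z hz
      exact h1 z (mem_univ _) hz

/-- The union of the streamline components meeting `K`. -/
def streamHull (ψ : S2 → ℝ) (K : Set S2) : Set S2 := {x | ∃ y ∈ K, x ∈ streamlineComponent ψ y}

/-- Cutoffs equal to 1 near single points of `K` are combined by `IsStreamCutoff.union` over a
finite subcover; constancy on components extends the value 1 to the hull. -/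
theorem exists_isStreamCutoff_hull {ψ : S2 → ℝ} (hψ : ContMDiff (𝓡 2) 𝓘(ℝ, ℝ) 1 ψ) {K : Set S2}
    (hK : IsCompact K) (hKp : ∀ y ∈ K, ψ y ≠ ψ southPole) {x : S2} (hx : x ∉ streamHull ψ K) :
    ∃ F, IsStreamCutoff ψ F ∧ (∀ᶠ z in 𝓝 x, F z = 0) ∧ ∀ y ∈ streamHull ψ K, F y = 1 := by
  suffices h : ∃ F, IsStreamCutoff ψ F ∧ (∀ᶠ z in 𝓝 x, F z = 0) ∧ ∀ y ∈ K, F y = 1 by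
    obtain ⟨F, hF, h0, h1⟩ := h
    refine ⟨F, hF, h0, ?_⟩
    rintro y ⟨z, hz, hyz⟩
    rw [hF.const z y hyz, h1 z hz]
  refine hK.induction_on (p := fun s => ∃ F, IsStreamCutoff ψ F ∧ (∀ᶠ z in 𝓝 x, F z = 0) ∧
    ∀ y ∈ s, F y = 1) ⟨_, IsStreamCutoff.zero ψ, by simp, by simp⟩ ?_ ?_ ?_
  · rintro s t hst ⟨F, hF, h0, h1⟩
    exact ⟨F, hF, h0, fun y hy => h1 y (hst hy)⟩
  · rintro s t ⟨F, hF, h0, h1⟩ ⟨F', hF', h0', h1'⟩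
    refine ⟨_, hF.union hF', ?_, ?_⟩
    · filter_upwards [h0, h0'] with z hz hz'
      simp [hz, hz']
    · rintro y (hy | hy)
      · simp [h1 y hy]
      · simp [h1' y hy]
  · intro y hy
    obtain ⟨F, hF, h0, h1⟩ := exists_isStreamCutoff_separating hψ (hKp y hy)
      (fun h => hx ⟨y, hy, h⟩)
    exact ⟨{z | F z = 1}, mem_nhdsWithin_of_mem_nhds h1, F, hF, h0, fun z hz => hz⟩

theorem isClosed_streamHull {ψ : S2 → ℝ} (hψ : ContMDiff (𝓡 2) 𝓘(ℝ, ℝ) 1 ψ) {K : Set S2}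
    (hK : IsCompact K) (hKp : ∀ y ∈ K, ψ y ≠ ψ southPole) : IsClosed (streamHull ψ K) := by
  rw [← isOpen_compl_iff, isOpen_iff_mem_nhds]
  intro x hx
  obtain ⟨F, -, h0, h1⟩ := exists_isStreamCutoff_hull hψ hK hKp hx
  filter_upwards [h0] with z hz hz'
  rw [h1 z hz'] at hz
  exact one_ne_zero hz

/-! ### Integrals over unions of streamline components -/

theorem continuous_surfaceGradient {f : S2 → ℝ} (hf : ContMDiff (𝓡 2) 𝓘(ℝ, ℝ) 1 f) :
    Continuous (surfaceGradient f) := by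
  rw [continuous_iff_continuousAt]
  intro x
  have h1 : ContinuousAt (fderiv ℝ (radialExtension f)) (x : E3) :=
    (contDiffAt_radialExtension hf (coe_ne_zero x)).continuousAt_fderiv one_ne_zero
  have h2 : ContinuousAt (fun x : S2 => fderiv ℝ (radialExtension f) (x : E3)) x :=
    ContinuousAt.comp (f := fun x : S2 => (x : E3)) h1 continuous_subtype_val.continuousAt
  exact (InnerProductSpace.toDual ℝ E3).symm.continuous.continuousAt.comp h2

theorem continuous_poissonBracket {f g : S2 → ℝ} (hf : ContMDiff (𝓡 2) 𝓘(ℝ, ℝ) 1 f)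
    (hg : ContMDiff (𝓡 2) 𝓘(ℝ, ℝ) 1 g) : Continuous (poissonBracket f g) := by
  have h1 := continuous_surfaceGradient hf
  have h2 := continuous_surfaceGradient hg
  have e1 : ∀ i, Continuous fun x => (surfaceGradient f x).ofLp i := fun i => by fun_prop
  have e2 : ∀ i, Continuous fun x => (surfaceGradient g x).ofLp i := fun i => by fun_prop
  have e3 : ∀ i, Continuous fun x : S2 => (x : E3).ofLp i := fun i => by fun_prop
  unfold poissonBracket
  simp only [cross_apply, dotProduct, Fin.sum_univ_three, Matrix.cons_val]
  fun_prop

theorem integrable_of_continuous {f : S2 → ℝ} (hf : Continuous f) : Integrable f area :=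
  hf.integrable_of_hasCompactSupport (HasCompactSupport.of_compactSpace f)

theorem measurable_stereoProj : Measurable stereoProj := by
  have hc : ∀ i, Measurable fun x : S2 => x.1 i := fun i =>
    (show Continuous fun x : S2 => x.1 i by fun_prop).measurable
  exact ((hc 0).div ((hc 2).const_add 1)).prodMk ((hc 1).div ((hc 2).const_add 1))

/-- By Lindelöf, countably many cutoffs equal to 1 on the hull cover its complement by their zero
sets. Their finite products tend pointwise to the indicator, and dominated convergence applies. -/
theorem setIntegral_streamHull {ψ φ : S2 → ℝ} (hψ : ContMDiff (𝓡 2) 𝓘(ℝ, ℝ) 1 ψ)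
    (hφ : ContMDiff (𝓡 2) 𝓘(ℝ, ℝ) 1 φ) {K : Set S2} (hK : IsCompact K)
    (hKp : ∀ y ∈ K, ψ y ≠ ψ southPole) :
    ∫ x in streamHull ψ K, poissonBracket ψ φ x ∂area = 0 := by
  have hcut := fun x : ((streamHull ψ K)ᶜ : Set S2) => exists_isStreamCutoff_hull hψ hK hKp x.2
  choose F hF hF0 hF1 using hcut
  have hQ : MeasurableSet (streamHull ψ K) := (isClosed_streamHull hψ hK hKp).measurableSet
  have hpole : southPole ∈ (streamHull ψ K)ᶜ := by
    rintro ⟨y, hy, h⟩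
    exact hKp y hy (eq_of_mem_streamlineComponent h).symm
  obtain ⟨T, hT, hTcov⟩ := TopologicalSpace.isOpen_iUnion_countable
    (fun x : ((streamHull ψ K)ᶜ : Set S2) => interior {z | F x z = 0}) fun x => isOpen_interior
  have hcov : ∀ z ∈ (streamHull ψ K)ᶜ, ∃ x ∈ T, F x z = 0 := by
    intro z hz
    have : z ∈ ⋃ x : ((streamHull ψ K)ᶜ : Set S2), interior {z | F x z = 0} :=
      mem_iUnion.2 ⟨⟨z, hz⟩, mem_interior_iff_mem_nhds.2 (hF0 ⟨z, hz⟩)⟩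
    rw [← hTcov] at this
    simp only [mem_iUnion] at this
    obtain ⟨x, hx, hzx⟩ := this
    exact ⟨x, hx, interior_subset (s := {z | F x z = 0}) hzx⟩
  have hTne : T.Nonempty := by
    obtain ⟨x, hx, -⟩ := hcov _ hpole
    exact ⟨x, hx⟩
  obtain ⟨e, rfl⟩ := hT.exists_eq_range hTne
  set f : ℕ → S2 → ℝ := fun n x => ∏ k ∈ Finset.range (n + 1), F (e k) x with hf
  have hfc : ∀ n, IsStreamCutoff ψ (f n) := by
    intro n
    induction n with
    | zero => simpa [hf] using hF (e 0)
    | succ n ih =>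
      have : f (n + 1) = fun x => f n x * F (e (n + 1)) x := by
        ext x
        simp only [hf, Finset.prod_range_succ _ (n + 1)]
      rw [this]
      exact ih.mul (hF _)
  have hfcont : ∀ n, AEStronglyMeasurable (f n) area := by
    intro n
    classical
    have h1 : Measurable fun x : S2 =>
        if x = southPole then f n southPole else (f n ∘ stereo) (stereoProj x) :=
      Measurable.ite (measurableSet_singleton southPole) measurable_const
        ((hfc n).contDiff.continuous.measurable.comp measurable_stereoProj)
    have h2 : (fun x : S2 => if x = southPole then f n southPole else
        (f n ∘ stereo) (stereoProj x)) = f n := by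
      ext x
      split_ifs with hx
      · rw [hx]
      · simp [stereo_stereoProj hx]
    rw [h2] at h1
    exact h1.aestronglyMeasurable
  have hint := integrable_of_continuous (continuous_poissonBracket hψ hφ)
  have hlim : Tendsto (fun n => ∫ x, f n x * poissonBracket ψ φ x ∂area) atTop
      (𝓝 (∫ x, (streamHull ψ K).indicator (poissonBracket ψ φ) x ∂area)) := by
    refine tendsto_integral_of_dominated_convergence (fun x => |poissonBracket ψ φ x|)
      (fun n => (hfcont n).mul hint.aestronglyMeasurable) hint.abs
      (fun n => Eventually.of_forall fun x => ?_) (Eventually.of_forall fun x => ?_)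
    · have := (hfc n).mem_Icc x
      rw [norm_mul, Real.norm_of_nonneg this.1]
      exact mul_le_of_le_one_left (norm_nonneg _) this.2
    · by_cases hx : x ∈ streamHull ψ K
      · rw [indicator_of_mem hx]
        have : ∀ n, f n x = 1 := fun n => Finset.prod_eq_one fun k _ => hF1 (e k) x hx
        simp [this]
      · rw [indicator_of_notMem hx]
        obtain ⟨_, ⟨k, rfl⟩, hk⟩ := hcov x hx
        refine tendsto_const_nhds.congr' ?_
        filter_upwards [eventually_ge_atTop k] with n hn
        have : f n x = 0 := Finset.prod_eq_zero (Finset.mem_range.2 (by omega)) hk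
        simp [this]
  rw [integral_indicator hQ] at hlim
  refine tendsto_nhds_unique hlim ?_
  simp_rw [(hfc _).integral_eq_zero hψ hφ]
  exact tendsto_const_nhds

theorem area_preimage_eq_zero {ψ : S2 → ℝ} (hψ : IsGeneric ψ) {N : Set ℝ} (hN : volume N = 0) :
    area (ψ ⁻¹' N) = 0 :=
  area_eq_zero_iff.2 (volume_preimage_eq_zero (contDiff_comp_stereo hψ.contMDiff)
    (volume_critical_comp_stereo hψ) hN)

/-- For a compact `K` nearly exhausting `Y`, the hull of `K` lies between `K` and `Y` by saturation.
The null polar level is removed first so that `K` avoids it. -/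
theorem setIntegral_saturated {ψ φ : S2 → ℝ} (hψ : IsGeneric ψ)
    (hφ : ContMDiff (𝓡 2) 𝓘(ℝ, ℝ) 1 φ) {Y : Set S2} (hY : NullMeasurableSet Y area)
    (hsat : ∀ x ∈ Y, streamlineComponent ψ x ⊆ Y) :
    ∫ x in Y, poissonBracket ψ φ x ∂area = 0 := by
  set f := poissonBracket ψ φ with hf
  have hfc : Continuous f := continuous_poissonBracket hψ.contMDiff hφ
  have hint := integrable_of_continuous hfc
  obtain ⟨C, hC⟩ := isCompact_univ.exists_bound_of_continuousOn hfc.continuousOn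
  have hP : area (ψ ⁻¹' {ψ southPole}) = 0 := area_preimage_eq_zero hψ (measure_singleton _)
  obtain ⟨Y', hY'Y, hY'm, hY'ae⟩ := (NullMeasurableSet.diff hY
    (NullMeasurableSet.of_null hP)).exists_measurable_subset_ae_eq
  have hYY' : Y' =ᵐ[area] Y := hY'ae.trans (sdiff_null_ae_eq_self hP)
  rw [← setIntegral_congr_set hYY']
  have hC0 : 0 ≤ C := (norm_nonneg _).trans (hC southPole (mem_univ _))
  have hbound : ∀ ε : ℝ, 0 < ε → ‖∫ x in Y', f x ∂area‖ ≤ C * ε := by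
    intro ε hε
    obtain ⟨K, hKY, hK, hKε⟩ := hY'm.exists_isCompact_sdiff_lt (measure_ne_top area Y')
      (ENNReal.ofReal_pos.2 hε).ne'
    have hKp : ∀ y ∈ K, ψ y ≠ ψ southPole := fun y hy => (hY'Y (hKY hy)).2
    have hQ : MeasurableSet (streamHull ψ K) :=
      (isClosed_streamHull hψ.contMDiff hK hKp).measurableSet
    have hKQ : K ⊆ streamHull ψ K := fun y hy => ⟨y, hy, mem_streamlineComponent_self _ _⟩
    have hQY : streamHull ψ K ⊆ Y := by
      rintro x ⟨y, hy, hxy⟩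
      exact hsat y (hY'Y (hKY hy)).1 hxy
    have e1 := setIntegral_sdiff hQ hint.integrableOn hQY (f := f)
    rw [setIntegral_streamHull hψ.contMDiff hφ hK hKp, sub_zero, ← setIntegral_congr_set hYY'] at e1
    rw [← e1]
    refine (norm_setIntegral_le_of_norm_le_const (measure_lt_top _ _)
      fun x _ => hC x (mem_univ x)).trans ?_
    refine mul_le_mul_of_nonneg_left ?_ hC0
    have e2 : area (Y \ streamHull ψ K) ≤ ENNReal.ofReal ε := by
      refine le_trans ?_ hKε.le
      refine (measure_mono (sdiff_subset_sdiff_right hKQ)).trans (le_of_eq ?_)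
      exact measure_congr (ae_eq_set_sdiff hYY'.symm (ae_eq_refl K))
    exact ENNReal.toReal_le_of_le_ofReal hε.le e2
  rw [← norm_le_zero_iff]
  refine le_of_forall_pos_le_add fun ε hε => ?_
  have hC1 : 0 < C + 1 := by linarith
  refine (hbound (ε / (C + 1)) (by positivity)).trans ?_
  rw [zero_add, mul_div_assoc', div_le_iff₀ hC1]
  nlinarith

/-- Layer cake: `w + M` is the integral over `a` in `(-M, M]` of the indicators of `{a < w}`, and
Fubini exchanges the integrals. -/
theorem integral_mul_eq_zero_of_superlevel {w f : S2 → ℝ} (hw : Measurable w) {M : ℝ}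
    (hM : ∀ x, |w x| ≤ M) (hf : Integrable f area)
    (h : ∀ a, ∫ x in {x | a < w x}, f x ∂area = 0) : ∫ x, w x * f x ∂area = 0 := by
  have hset : ∀ a, MeasurableSet {x | a < w x} := fun a => measurableSet_lt measurable_const hw
  have h0 : ∫ x, f x ∂area = 0 := by
    -- Below `-M` the superlevel set is everything, so `f` itself integrates to zero and the shift
    -- by `M` is harmless.
    have := h (-M - 1)
    rwa [show {x | -M - 1 < w x} = univ from eq_univ_of_forall fun x => by
      have := (abs_le.1 (hM x)).1
      simp only [mem_ofPred_eq]; linarith, setIntegral_univ] at this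
  have hwf : Integrable (fun x => w x * f x) area :=
    hf.bdd_mul hw.aestronglyMeasurable (c := M) (Eventually.of_forall hM)
  have hslice : ∀ x, ∫ a in Ioc (-M) M, (Iio (w x)).indicator (fun _ => f x) a = w x * f x + M * f x := by
    intro x
    have hx := abs_le.1 (hM x)
    rw [setIntegral_indicator measurableSet_Iio, setIntegral_const]
    have : volume.real (Ioc (-M) M ∩ Iio (w x)) = w x + M := by
      have e : Ioc (-M) M ∩ Iio (w x) = Ioo (-M) (w x) := by
        ext a
        simp only [mem_inter_iff, mem_Ioc, mem_Iio, mem_Ioo]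
        constructor
        · rintro ⟨⟨h1, -⟩, h2⟩; exact ⟨h1, h2⟩
        · rintro ⟨h1, h2⟩; exact ⟨⟨h1, h2.le.trans hx.2⟩, h2⟩
      rw [e, Measure.real, Real.volume_Ioo, ENNReal.toReal_ofReal (by linarith)]
      ring
    rw [this, smul_eq_mul]
    ring
  have hS : MeasurableSet {z : S2 × ℝ | z.2 < w z.1} :=
    measurableSet_lt measurable_snd (hw.comp measurable_fst)
  have hprod : Integrable (Function.uncurry fun (x : S2) (a : ℝ) => (Iio (w x)).indicator (fun _ => f x) a)
      (area.prod (volume.restrict (Ioc (-M) M))) := by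
    have h1 : Integrable (fun z : S2 × ℝ => f z.1) (area.prod (volume.restrict (Ioc (-M) M))) :=
      hf.comp_fst _
    exact (h1.indicator hS).congr (Eventually.of_forall fun z => rfl)
  have key := integral_integral_swap hprod
  simp_rw [hslice] at key
  rw [integral_add hwf (hf.const_mul M), integral_const_mul, h0, mul_zero, add_zero] at key
  rw [key]
  have : ∀ a, ∫ x, (Iio (w x)).indicator (fun _ => f x) a ∂area = 0 := by
    intro a
    rw [← h a, ← integral_indicator (hset a)]
    rfl
  simp [this]

theorem integral_mul_poissonBracket_eq_zero {ψ φ w g : S2 → ℝ} (hψ : IsGeneric ψ)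
    (hφ : ContMDiff (𝓡 2) 𝓘(ℝ, ℝ) 1 φ) (hw : Measurable w) {M : ℝ} (hM : ∀ x, |w x| ≤ M)
    (hg : IsConstantOnStreamlineComponents ψ g) (hwg : w =ᵐ[area] g) :
    ∫ x, w x * poissonBracket ψ φ x ∂area = 0 := by
  refine integral_mul_eq_zero_of_superlevel hw hM
    (integrable_of_continuous (continuous_poissonBracket hψ.contMDiff hφ)) fun a => ?_
  have hae : {x | a < w x} =ᵐ[area] {x | a < g x} := by
    filter_upwards [hwg] with x hx
    have : (a < w x) = (a < g x) := by rw [hx]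
    exact this
  rw [setIntegral_congr_set hae]
  refine setIntegral_saturated hψ hφ
    ((measurableSet_lt measurable_const hw).nullMeasurableSet.congr hae) fun x hx y hy => ?_
  have : g y = g x := hg x y hy
  simpa [this] using hx

end StreamlineAveraging

end

noncomputable section

namespace StreamlineAveraging

open Filter Topology Set

/-! ### Lengths of level sets -/

section Eilenberg

variable {X : Type*} [MetricSpace X] [MeasurableSpace X] [BorelSpace X]

theorem exists_cover_of_hausdorffMeasure {A : Set X} (hA : μH[2] A ≠ ⊤) {r : ENNReal} (hr : 0 < r) :
    ∃ t : ℕ → Set X, A ⊆ ⋃ i, t i ∧ (∀ i, ediam (t i) ≤ r) ∧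
      ∑' i, ediam (t i) ^ (2 : ℝ) ≤ μH[2] A + r := by
  have h1 := Measure.hausdorffMeasure_apply (2 : ℝ) A
  have h2 : (⨅ (t : ℕ → Set X) (_ : A ⊆ ⋃ n, t n) (_ : ∀ n, ediam (t n) ≤ r),
      ∑' n, ⨆ _ : (t n).Nonempty, ediam (t n) ^ (2 : ℝ)) < μH[2] A + r := by
    refine lt_of_le_of_lt ?_ (ENNReal.lt_add_right hA hr.ne')
    rw [h1]
    exact le_iSup₂ (f := fun (r : ENNReal) (_ : 0 < r) =>
      ⨅ (t : ℕ → Set X) (_ : A ⊆ ⋃ n, t n) (_ : ∀ n, ediam (t n) ≤ r),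
        ∑' n, ⨆ _ : (t n).Nonempty, ediam (t n) ^ (2 : ℝ)) r hr
  simp only [iInf_lt_iff] at h2
  obtain ⟨t, ht, htr, hlt⟩ := h2
  refine ⟨t, ht, htr, le_trans (ENNReal.tsum_le_tsum fun i => ?_) hlt.le⟩
  rcases (t i).eq_empty_or_nonempty with h | h
  · simp [h]
  · simp [h]

/-- **Eilenberg's inequality** for a real Lipschitz function on a set of finite two-dimensional
measure. -/
theorem exists_measurable_hausdorffMeasure_fiber_le {A : Set X} (hA : μH[2] A ≠ ⊤) {K : NNReal}
    {f : X → ℝ} (hf : LipschitzOnWith K f A) :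
    ∃ g : ℝ → ENNReal, Measurable g ∧ (∀ c, μH[1] (A ∩ f ⁻¹' {c}) ≤ g c) ∧
      ∫⁻ c, g c ≤ 2 * K * μH[2] A := by
  classical
  set r : ℕ → ENNReal := fun n => ((n : ENNReal) + 1)⁻¹ with hrdef
  have hr : ∀ n, 0 < r n := fun n => ENNReal.inv_pos.2 (by finiteness)
  have hrlim : Tendsto r atTop (𝓝 0) := by
    have := (tendsto_add_atTop_iff_nat 1).2 ENNReal.tendsto_inv_nat_nhds_zero
    simpa [hrdef] using this
  choose t ht htr hts using fun n => exists_cover_of_hausdorffMeasure hA (hr n)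
  -- Each piece maps into an interval of length at most `2 * K` times its diameter. A fibre meets
  -- the piece only if its value lies there, so integrating the covering sums in `c` gives squared
  -- diameters.
  set J : ℕ → ℕ → Set ℝ := fun n i => if h : (t n i ∩ A).Nonempty then
    Metric.closedEBall (f h.some) (K * ediam (t n i)) else ∅ with hJ
  have hJm : ∀ n i, MeasurableSet (J n i) := by
    intro n i
    simp only [hJ]
    split_ifs
    · exact isClosed_closedEBall.measurableSet
    · exact MeasurableSet.empty
  have hJv : ∀ n i, volume (J n i) ≤ 2 * (K * ediam (t n i)) := by
    intro n i
    simp only [hJ]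
    split_ifs
    · rw [Real.volume_closedEBall]
    · simp
  have hJmem : ∀ n i, ∀ x ∈ t n i ∩ A, f x ∈ J n i := by
    intro n i x hx
    have h : (t n i ∩ A).Nonempty := ⟨x, hx⟩
    simp only [hJ, dif_pos h]
    refine (hf hx.2 h.some_mem.2).trans ?_
    gcongr
    exact edist_le_ediam_of_mem hx.1 h.some_mem.1
  set g : ℕ → ℝ → ENNReal := fun n c => ∑' i, (J n i).indicator (fun _ => ediam (t n i)) c with hg
  have hgm : ∀ n, Measurable (g n) := fun n =>
    Measurable.tsum fun i => measurable_const.indicator (hJm n i)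
  refine ⟨fun c => liminf (fun n => g n c) atTop, Measurable.liminf hgm, fun c => ?_, ?_⟩
  · refine (Measure.hausdorffMeasure_le_liminf_tsum (ι := fun _ => ℕ) 1 _ r hrlim
      (fun n i => t n i ∩ (A ∩ f ⁻¹' {c}))
      (Eventually.of_forall fun n i => (ediam_mono inter_subset_left).trans (htr n i))
      (Eventually.of_forall fun n x hx => ?_)).trans ?_
    · obtain ⟨i, hi⟩ := mem_iUnion.1 (ht n hx.1)
      exact mem_iUnion.2 ⟨i, hi, hx⟩
    · refine liminf_le_liminf (Eventually.of_forall fun n => ENNReal.tsum_le_tsum fun i => ?_)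
      rw [ENNReal.rpow_one]
      by_cases hc : c ∈ J n i
      · rw [indicator_of_mem hc]
        exact ediam_mono inter_subset_left
      · have : t n i ∩ (A ∩ f ⁻¹' {c}) = ∅ := by
          rw [eq_empty_iff_forall_notMem]
          rintro x ⟨hx, hxA, rfl⟩
          exact hc (hJmem n i x ⟨hx, hxA⟩)
        simp [this]
  · have hint : ∀ n, ∫⁻ c, g n c ≤ 2 * K * (μH[2] A + r n) := by
      intro n
      rw [lintegral_tsum fun i => (measurable_const.indicator (hJm n i)).aemeasurable]
      calc ∑' i, ∫⁻ c, (J n i).indicator (fun _ => ediam (t n i)) c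
          ≤ ∑' i, 2 * K * ediam (t n i) ^ (2 : ℝ) := by
            refine ENNReal.tsum_le_tsum fun i => ?_
            rw [lintegral_indicator_const (hJm n i)]
            calc ediam (t n i) * volume (J n i)
                ≤ ediam (t n i) * (2 * (K * ediam (t n i))) := by gcongr; exact hJv n i
              _ = 2 * K * ediam (t n i) ^ (2 : ℝ) := by
                rw [ENNReal.rpow_two]; ring
        _ = 2 * K * ∑' i, ediam (t n i) ^ (2 : ℝ) := ENNReal.tsum_mul_left
        _ ≤ 2 * K * (μH[2] A + r n) := by gcongr; exact hts n
    refine (lintegral_liminf_le hgm).trans ((liminf_le_liminf (Eventually.of_forall hint)).trans ?_)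
    have hlim : Tendsto (fun n => 2 * K * (μH[2] A + r n)) atTop (𝓝 (2 * K * (μH[2] A + 0))) :=
      ENNReal.Tendsto.const_mul (tendsto_const_nhds.add hrlim) (Or.inr (by finiteness))
    rw [add_zero] at hlim
    exact hlim.liminf_eq.le

theorem ae_hausdorffMeasure_fiber_lt_top {A : Set X} (hA : μH[2] A ≠ ⊤) {K : NNReal}
    {f : X → ℝ} (hf : LipschitzOnWith K f A) : ∀ᵐ c, μH[1] (A ∩ f ⁻¹' {c}) < ⊤ := by
  obtain ⟨g, hg, hle, hint⟩ := exists_measurable_hausdorffMeasure_fiber_le hA hf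
  filter_upwards [ae_lt_top hg (ne_top_of_le_ne_top (by finiteness) hint)] with c hc
  exact (hle c).trans_lt hc

theorem ae_hausdorffMeasure_fiber_eq_zero {A : Set X} (hA : μH[2] A = 0) {K : NNReal}
    {f : X → ℝ} (hf : LipschitzOnWith K f A) : ∀ᵐ c, μH[1] (A ∩ f ⁻¹' {c}) = 0 := by
  obtain ⟨g, hg, hle, hint⟩ := exists_measurable_hausdorffMeasure_fiber_le (by simp [hA]) hf
  rw [hA, mul_zero, nonpos_iff_eq_zero, lintegral_eq_zero_iff hg] at hint
  filter_upwards [hint] with c hc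
  exact le_antisymm ((hle c).trans_eq hc) zero_le

/-- The distance to one point is 1-Lipschitz and maps the set onto a set containing a nondegenerate
interval. -/
theorem hausdorffMeasure_one_pos_of_isPreconnected {s : Set X} (hs : IsPreconnected s)
    (hn : ¬ s.Subsingleton) : 0 < μH[1] s := by
  obtain ⟨a, ha, b, hb, hab⟩ := not_subsingleton_iff.1 hn
  have hL : LipschitzOnWith 1 (dist a) s := (LipschitzWith.dist_right a).lipschitzOnWith
  have hc : IsPreconnected (dist a '' s) := hs.image _ hL.continuousOn
  have hsub : Icc 0 (dist a b) ⊆ dist a '' s :=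
    hc.Icc_subset ⟨a, ha, dist_self a⟩ ⟨b, hb, rfl⟩
  have h1 := hL.hausdorffMeasure_image_le (d := 1) zero_le_one
  have h2 : (0 : ENNReal) < volume (Icc 0 (dist a b)) := by
    rw [Real.volume_Icc]
    simpa using hab
  have h3 := measure_mono (μ := volume) hsub
  rw [← hausdorffMeasure_real] at h2 h3
  simpa using h2.trans_le (h3.trans h1)

end Eilenberg

/-! ### The averaging projector -/

theorem exists_lipschitzOnWith_stereo (R : ℝ) :
    ∃ L : NNReal, LipschitzOnWith L stereo (closedBall 0 R) := by
  have hs : ContDiff ℝ 1 fun p => (stereo p : E3) := by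
    simp_rw [coe_stereo]
    refine ContDiff.smul (ContDiff.inv ?_ fun p => (stereoDen_pos p).ne') contDiff_stereoVec
    unfold stereoDen
    fun_prop
  obtain ⟨C, hC⟩ := (isCompact_closedBall (0 : ℝ × ℝ) R).exists_bound_of_continuousOn
    (hs.continuous_fderiv one_ne_zero).continuousOn
  refine ⟨C.toNNReal, LipschitzOnWith.of_dist_le' fun x hx y hy => ?_⟩
  rw [Subtype.dist_eq, dist_eq_norm, dist_eq_norm]
  exact (convex_closedBall (0 : ℝ × ℝ) R).norm_image_sub_le_of_norm_fderiv_le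
    (fun z _ => hs.differentiable one_ne_zero z) hC hy hx

theorem isClosed_streamlineComponent {ψ : S2 → ℝ} (hψ : Continuous ψ) (x : S2) :
    IsClosed (streamlineComponent ψ x) := by
  have hE : IsClosed (ψ ⁻¹' {ψ x}) := isClosed_singleton.preimage hψ
  rw [streamlineComponent, connectedComponentIn_eq_image (by rfl : x ∈ ψ ⁻¹' {ψ x})]
  exact hE.isClosedEmbedding_subtypeVal.isClosedMap _ isClosed_connectedComponent

theorem streamlineAverage_ae_eq {ψ w g : S2 → ℝ} (hψ : IsGeneric ψ)
    (hg : IsConstantOnStreamlineComponents ψ g) (hwg : w =ᵐ[area] g) :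
    streamlineAverage ψ w =ᵐ[area] w := by
  have hψc : Continuous ψ := hψ.contMDiff.continuous
  set Z : Set (ℝ × ℝ) := {p | w (stereo p) ≠ g (stereo p)} with hZ
  have hZ0 : volume Z = 0 := ae_area_iff.1 hwg
  -- Eilenberg's inequality on each ball, once for the ball itself and once for the null set `Z`.
  have hgood : ∀ᵐ c : ℝ, c ≠ ψ southPole ∧ ∀ n : ℕ,
      μH[1] (closedBall (0 : ℝ × ℝ) n ∩ (ψ ∘ stereo) ⁻¹' {c}) < ⊤ ∧
      μH[1] ((Z ∩ closedBall (0 : ℝ × ℝ) n) ∩ (ψ ∘ stereo) ⁻¹' {c}) = 0 := by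
    have h1 : ∀ᵐ c : ℝ, c ≠ ψ southPole :=
      measure_eq_zero_iff_ae_notMem.1 (measure_singleton (ψ southPole))
    refine h1.and (ae_all_iff.2 fun n => ?_)
    obtain ⟨C, hC⟩ := exists_lipschitzOnWith_closedBall (contDiff_comp_stereo hψ.contMDiff) n
    refine (ae_hausdorffMeasure_fiber_lt_top ?_ hC).and
      (ae_hausdorffMeasure_fiber_eq_zero ?_ (hC.mono inter_subset_right))
    · rw [hausdorffMeasure_prod_real]
      exact (isCompact_closedBall _ _).measure_lt_top.ne
    · rw [hausdorffMeasure_prod_real]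
      exact measure_mono_null inter_subset_left hZ0
  have hae : ∀ᵐ x ∂area, ψ x ∉ {c : ℝ | ¬ (c ≠ ψ southPole ∧ ∀ n : ℕ,
      μH[1] (closedBall (0 : ℝ × ℝ) n ∩ (ψ ∘ stereo) ⁻¹' {c}) < ⊤ ∧
      μH[1] ((Z ∩ closedBall (0 : ℝ × ℝ) n) ∩ (ψ ∘ stereo) ⁻¹' {c}) = 0)} :=
    measure_eq_zero_iff_ae_notMem.1 (area_preimage_eq_zero hψ hgood)
  filter_upwards [hae, hwg] with x hx hwx
  obtain ⟨hpole, hn⟩ := not_not.1 hx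
  set γ := streamlineComponent ψ x with hγ
  unfold streamlineAverage
  split_ifs with hsub
  · rfl
  have hγm : MeasurableSet γ := (isClosed_streamlineComponent hψc x).measurableSet
  have hγc : IsCompact γ := (isClosed_streamlineComponent hψc x).isCompact
  have hγp : ∀ y ∈ γ, y ≠ southPole := fun y hy => ne_southPole_of_mem_streamlineComponent hpole hy
  -- The component is compact and avoids the pole, so its chart image is bounded; `stereo` is
  -- Lipschitz there and transfers the length estimates.
  obtain ⟨R, hR⟩ := (hγc.image_of_continuousOn
    (continuousOn_stereoProj.mono hγp)).isBounded.subset_closedBall 0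
  obtain ⟨n, hRn⟩ := exists_nat_ge R
  have hmem : ∀ y ∈ γ, stereoProj y ∈ closedBall (0 : ℝ × ℝ) n ∩ (ψ ∘ stereo) ⁻¹' {ψ x} := by
    intro y hy
    refine ⟨closedBall_subset_closedBall hRn (hR ⟨y, hy, rfl⟩), ?_⟩
    simp [stereo_stereoProj (hγp y hy), eq_of_mem_streamlineComponent hy]
  obtain ⟨L, hL⟩ := exists_lipschitzOnWith_stereo n
  have hfin : μH[1] γ ≠ ⊤ := by
    refine ne_top_of_le_ne_top ?_ ((measure_mono ?_).trans
      ((hL.mono (inter_subset_left (t := (ψ ∘ stereo) ⁻¹' {ψ x}))).hausdorffMeasure_image_le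
        zero_le_one))
    · exact ENNReal.mul_ne_top (by simp) (hn n).1.ne
    · exact fun y hy => ⟨stereoProj y, hmem y hy, stereo_stereoProj (hγp y hy)⟩
  have hbad : μH[1] {y | y ∈ γ ∧ w y ≠ g y} = 0 := by
    have hL' : LipschitzOnWith L stereo
        ((Z ∩ closedBall (0 : ℝ × ℝ) n) ∩ (ψ ∘ stereo) ⁻¹' {ψ x}) :=
      hL.mono (inter_subset_left.trans inter_subset_right)
    have h1 := hL'.hausdorffMeasure_image_le (d := 1) zero_le_one
    rw [(hn n).2, mul_zero, nonpos_iff_eq_zero] at h1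
    refine measure_mono_null (fun y hy => ?_) h1
    have hy' := hmem y hy.1
    refine ⟨stereoProj y, ⟨⟨?_, hy'.1⟩, hy'.2⟩, stereo_stereoProj (hγp y hy.1)⟩
    simpa [hZ, stereo_stereoProj (hγp y hy.1)] using hy.2
  have hconst : w =ᵐ[(μH[1] : Measure S2).restrict γ] fun _ => w x := by
    rw [EventuallyEq, ae_restrict_iff' hγm, ae_iff]
    refine measure_mono_null (fun y hy => ?_) hbad
    simp only [mem_ofPred_eq, Classical.not_imp] at hy
    refine ⟨hy.1, fun h => hy.2 ?_⟩
    rw [h, hg x y hy.1, hwx]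
  rw [average_congr hconst]
  exact setAverage_const
    (hausdorffMeasure_one_pos_of_isPreconnected (isPreconnected_streamlineComponent ψ x) hsub).ne'
    hfin _

theorem isConstantOn_streamlineAverage (ψ f : S2 → ℝ) :
    IsConstantOnStreamlineComponents ψ (streamlineAverage ψ f) := by
  intro x y hy
  unfold streamlineAverage
  rw [streamlineComponent_eq hy]
  split_ifs with h
  · rw [h hy (mem_streamlineComponent_self ψ x)]
  · rfl

/-! ### The two characterisations of the stabiliser. -/

theorem streamlineAverage_ae_eq_iff {ψ w : S2 → ℝ} (hψ : IsGeneric ψ) :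
    streamlineAverage ψ w =ᵐ[area] w ↔
      ∃ g, IsConstantOnStreamlineComponents ψ g ∧ w =ᵐ[area] g :=
  ⟨fun h => ⟨_, isConstantOn_streamlineAverage ψ w, h.symm⟩,
    fun ⟨_, hg, hwg⟩ => streamlineAverage_ae_eq hψ hg hwg⟩

/-- A measurable version is truncated at the essential supremum; the preceding arguments use a Borel
function bounded everywhere. -/
theorem exists_bounded_measurable_representative {w : S2 → ℝ} (hw : MemLp w ⊤ area) :
    ∃ w' : S2 → ℝ, Measurable w' ∧ (∃ M : ℝ, ∀ x, |w' x| ≤ M) ∧ w =ᵐ[area] w' := by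
  set M := (eLpNorm w ⊤ area).toReal with hM
  have hM0 : 0 ≤ M := ENNReal.toReal_nonneg
  have hb : ∀ᵐ x ∂area, |w x| ≤ M := by
    have h1 := enorm_ae_le_eLpNormEssSup w area
    filter_upwards [h1] with x hx
    rw [← eLpNorm_exponent_top] at hx
    exact (toReal_enorm (w x)).symm.trans_le (ENNReal.toReal_mono hw.2.ne hx)
  have hwm := hw.1
  refine ⟨fun x => max (-M) (min M (hwm.mk w x)),
    measurable_const.max (measurable_const.min hwm.stronglyMeasurable_mk.measurable),
    ⟨M, fun x => abs_le.2 ⟨le_max_left _ _, max_le (by linarith) (min_le_left _ _)⟩⟩, ?_⟩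
  filter_upwards [hb, hwm.ae_eq_mk] with x hx hx'
  rw [← hx', min_eq_right (abs_le.1 hx).2, max_eq_right (abs_le.1 hx).1]

theorem mem_stab_iff {ψ w : S2 → ℝ} (hψ : IsGeneric ψ) (hw : MemLp w ⊤ area) :
    w ∈ stab ψ ↔ ∃ g, IsConstantOnStreamlineComponents ψ g ∧ w =ᵐ[area] g := by
  obtain ⟨w', hw'm, ⟨M, hM⟩, hww'⟩ := exists_bounded_measurable_representative hw
  have hweak : ∀ φ, weakPoissonBracket ψ w φ = weakPoissonBracket ψ w' φ := by
    intro φ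
    unfold weakPoissonBracket
    rw [integral_congr_ae]
    filter_upwards [hww'] with x hx
    rw [hx]
  constructor
  · rintro ⟨-, h⟩
    obtain ⟨g, hg, hwg⟩ := exists_isConstantOn_of_stab hψ hw'm hM
      fun φ hφ => (hweak φ).symm.trans (h φ hφ)
    exact ⟨g, hg, hww'.trans hwg⟩
  · rintro ⟨g, hg, hwg⟩
    refine ⟨hw.mono_exponent le_top, fun φ hφ => ?_⟩
    rw [hweak, weakPoissonBracket, integral_mul_poissonBracket_eq_zero hψ (hφ.of_le (by simp)) hw'm
      hM hg (hww'.symm.trans hwg), neg_zero]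

end StreamlineAveraging

end

theorem mainTheorem5 (ψ : StreamlineAveraging.S2 → ℝ) (hψ : StreamlineAveraging.IsGeneric ψ)
    (w : StreamlineAveraging.S2 → ℝ) (hw : MemLp w ⊤ StreamlineAveraging.area) :
    (w ∈ StreamlineAveraging.stab ψ ↔
      StreamlineAveraging.streamlineAverage ψ w =ᵐ[StreamlineAveraging.area] w) ∧
    (w ∈ StreamlineAveraging.stab ψ ↔
      ∃ g : StreamlineAveraging.S2 → ℝ,
        StreamlineAveraging.IsConstantOnStreamlineComponents ψ g ∧
          w =ᵐ[StreamlineAveraging.area] g) :=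
  ⟨(StreamlineAveraging.mem_stab_iff hψ hw).trans
      (StreamlineAveraging.streamlineAverage_ae_eq_iff hψ).symm,
    StreamlineAveraging.mem_stab_iff hψ hw⟩
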